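/- Let $N\ge 3$, $\mu\in\mathbb R$, $\sigma>0$, $\xi\ne 0$, and let $x_1,\dots,x_N,x_{N+1}$ be independent random variables with the Generalised Pareto density $\frac1\sigma\bigl(1+\xi\frac{x-\mu}{\sigma}\bigr)^{-1-1/\xi}$ on $\{x>\mu,\ 1+\xi\frac{x-\mu}\sigma>0\}$. Let $X_1\le\dots\le X_N$ be the ordered values of $x_1,\dots,x_N$, and put $$t_j=\frac{X_{j+1}-X_1}{X_N-X_1}\ (1\le j\le N-2),\qquad s=\frac{x_{N+1}-X_1}{X_N-X_1},\qquad \mathbf t=(t_1,\dots,t_{N-2}),$$ so that $\mathbf t$ lies in $A=\{0\le t_1\le\dots\le t_{N-2}\le 1\}$. Then $(\mathbf t,s)$ has a joint density $p(s,\mathbf t\,|\,\xi)$ with respect to Lebesgue measure. For $u>1$ write $$G(u|\xi)\,p(\mathbf t|\xi):=\int_u^\infty p(s,\mathbf t\,|\,\xi)\,ds .$$ For every measurable predictor $s_T$ with $s_T>1$ on $A$, $$P(s>s_T(\mathbf t)\,|\,\xi)=\int_A G(s_T(\mathbf t)|\xi)\,p(\mathbf t|\xi)\,d\mathbf t .$$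 Moreover, for almost every $\mathbf t\in A$ and all $s_T>1$ (in particular for $s_T=s_T(\mathbf t)$), the following holds, where $N_1=N-1$ and $F_D^{(d)}$ denotes the Lauricella function $$F_D^{(d)}(a,b_1,\dots,b_d;c;z_1,\dots,z_d)=\sum_{m\in\mathbb N^d}\frac{(a)_{m_1+\dots+m_d}\prod_i (b_i)_{m_i}}{(c)_{m_1+\dots+m_d}\prod_i m_i!}\prod_i z_i^{m_i},$$ with $(a)_k=a(a+1)\cdots(a+k-1)$ (the series below converge absolutely). (i) If $\xi>0$ and $\alpha=1/\xi$, then $$G(s_T|\xi)\,p(\mathbf t|\xi)=\frac{N!}{N+1}\,\alpha^{N_1}\,\frac{\Gamma(N_1)\Gamma(N\alpha)}{\Gamma(N_1+N\alpha)}\,\frac{t_1^{N_1\alpha-1}}{(t_2\cdots t_{N-2})^{1+\alpha}\,s_T^{\alpha}}\,F_D^{(N-1)}\bigl(N\alpha,\underbrace{1+\alpha,\dots,1+\alpha}_{N-2},\alpha;\,N_1+N\alpha;\,\kappa_2,\dots,\kappa_N\bigr),$$ where $\kappa_j=1-t_1/t_j$ for $j=2,\dots,N$, with $t_{N-1}=1$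 and $t_N=s_T$. (ii) If $\xi<0$ and $\beta=-1/\xi$, then $$G(s_T|\xi)\,p(\mathbf t|\xi)=\frac{N!}{N+1}\,\beta^{N_1}\,\frac{\Gamma(N_1)\Gamma(1+\beta)}{\Gamma(N+\beta)}\,\frac1{s_T^{N_1}}\,F_D^{(N-1)}\Bigl(N_1,\underbrace{1-\beta,\dots,1-\beta}_{N-1};\,N+\beta;\,\tfrac{t_1}{s_T},\dots,\tfrac{t_{N-2}}{s_T},\tfrac1{s_T}\Bigr).$$ -/

import Mathlib

open MeasureTheory ProbabilityTheory Set

noncomputable section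

namespace GPDPredictor

/-- Density of the Generalised Pareto Distribution with location `μ`, scale `σ > 0`, shape `ξ`:
`(1/σ) (1 + ξ (x - μ)/σ)^(-1 - 1/ξ)` on the support `x > μ`, `1 + ξ (x - μ)/σ > 0`
(for `ξ = 0` the exponential density). -/
def gpdPDF (μ σ ξ x : ℝ) : ℝ :=
  if ξ = 0 then (if μ < x then σ⁻¹ * Real.exp (-((x - μ) / σ)) else 0)
  else if μ < x ∧ 0 < 1 + ξ * ((x - μ) / σ) then
    σ⁻¹ * (1 + ξ * ((x - μ) / σ)) ^ (-1 - 1 / ξ)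
  else 0

/-- The Generalised Pareto Distribution. -/
def gpd (μ σ ξ : ℝ) : Measure ℝ :=
  volume.withDensity fun x => ENNReal.ofReal (gpdPDF μ σ ξ x)

/-- The ordered data, from the lowest order statistic to the highest. -/
def ordered {k : ℕ} (x : Fin k → ℝ) : Fin k → ℝ := x ∘ Tuple.sort x

/-- The normalised data `t_j = (X_{j+1} - X_1) / (X_N - X_1)`, `j = 1, …, N - 2`, of a sample of
size `N = n + 3` (the zero-based entry `j` is `t_{j+1}`). -/
def normData {n : ℕ} (x : Fin (n + 3) → ℝ) : Fin (n + 1) → ℝ := fun j =>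
  (ordered x j.succ.castSucc - ordered x 0) / (ordered x (Fin.last (n + 2)) - ordered x 0)

/-- A further data point `y`, normalised by the sample `x`: `(y - X_1) / (X_N - X_1)`. -/
def normPoint {n : ℕ} (x : Fin (n + 3) → ℝ) (y : ℝ) : ℝ :=
  (y - ordered x 0) / (ordered x (Fin.last (n + 2)) - ordered x 0)

/-- From `N + 1 = n + 4` data points, the last being `x_{N+1}`, the pair `(t, s)`. -/
def normPair {n : ℕ} (x : Fin (n + 4) → ℝ) : (Fin (n + 1) → ℝ) × ℝ :=
  (normData (Fin.init x), normPoint (Fin.init x) (x (Fin.last (n + 3))))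

/-- The admissible normalised data `0 ≤ t_1 ≤ … ≤ t_{N-2} ≤ 1`. -/
def admissible (n : ℕ) : Set (Fin (n + 1) → ℝ) :=
  {t | Monotone t ∧ ∀ j, t j ∈ Icc (0 : ℝ) 1}

/-- For a joint law `J` of `(t, s)` with joint density `p(s, t)` with respect to Lebesgue measure,
the exceedance integrand `∫_u^∞ p(s, t) ds` at `t` and level `u`. -/
def exceedanceIntegrand {n : ℕ} (J : Measure ((Fin (n + 1) → ℝ) × ℝ)) (t : Fin (n + 1) → ℝ)
    (u : ℝ) : ENNReal :=
  ∫⁻ s in Ioi u, J.rnDeriv volume (t, s)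

/-- The Pochhammer symbol `(a)_k = a (a + 1) ⋯ (a + k - 1)`. -/
def poch (a : ℝ) (k : ℕ) : ℝ := (ascPochhammer ℝ k).eval a

/-- The term of multi-index `m` in the Lauricella series `F_D^{(d)}(a, b; c; x)`. -/
def lauricellaTerm {d : ℕ} (a : ℝ) (b : Fin d → ℝ) (c : ℝ) (x : Fin d → ℝ) (m : Fin d → ℕ) : ℝ :=
  poch a (∑ i, m i) * (∏ i, poch (b i) (m i)) / (poch c (∑ i, m i) * ∏ i, ((m i).factorial : ℝ))
    * ∏ i, x i ^ m i

/-- The Lauricella function `F_D^{(d)}(a, b; c; x)` (for `|x_i| < 1`), as its defining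
`d`-fold power series. -/
def lauricellaFD {d : ℕ} (a : ℝ) (b : Fin d → ℝ) (c : ℝ) (x : Fin d → ℝ) : ℝ :=
  ∑' m : Fin d → ℕ, lauricellaTerm a b c x m

/-- Parameters `(1 + α, …, 1 + α, α)`, of length `N - 1 = n + 2`. -/
def heavyParams (n : ℕ) (α : ℝ) : Fin (n + 2) → ℝ :=
  Fin.snoc (α := fun _ => ℝ) (fun _ : Fin (n + 1) => 1 + α) α

/-- Arguments `κ_j = 1 - t_1 / t_j`, `j = 2, …, N`, where `t_{N-1} = 1` and `t_N = u`. -/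
def kappa {n : ℕ} (t : Fin (n + 1) → ℝ) (u : ℝ) : Fin (n + 2) → ℝ := fun i =>
  1 - t 0 / Fin.snoc (α := fun _ => ℝ) (Fin.snoc (α := fun _ => ℝ) (Fin.tail t) 1) u i

/-- Arguments `(t_1 / u, …, t_{N-2} / u, 1 / u)`. -/
def boundedArgs {n : ℕ} (t : Fin (n + 1) → ℝ) (u : ℝ) : Fin (n + 2) → ℝ := fun i =>
  Fin.snoc (α := fun _ => ℝ) t 1 i / u

end GPDPredictor

end

noncomputable section

namespace GPDPredictor

/-! Sorting the sample costs a factor N! and restricts it to monotone tuples. Such a tuple is given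
by its minimum m, its range r and the normalised middle points t, with Jacobian r^(N-2); writing the
new point as m + rs costs one more r. Hence, with f the common density, (t, s) has density N! ∫∫
r^(N-1) f(m) ∏ f(m + r t_j) f(m + r) f(m + rs) dr dm on A (`map_normPair`). Integrating over s > u
turns the last factor into a survival function (`lintegral_jointDensity_Ioi`).

Threshold stability then decouples the two integrals. With Y = 1 + ξ(m - μ)/σ and S(m) = Y^(-1/ξ)
the survival function, measuring r in units of σY/|ξ| splits the integrand into |ξ|^(-(N-1)) f(m)
S(m)^N and a function of the rescaled range w alone. The m-integral is 1/(N+1), so μ and σ disappear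
(`exceedance_gpd`).

What remains is a one-dimensional integral in w. The substitution w = (1/v - 1)/t_1 for ξ > 0, or w
= v/u for ξ < 0, makes it Euler's integral for F_D (`lauricella_euler`). The multiple integrals are
Lebesgue integrals of nonnegative functions, so exchanging their order needs only measurability. -/

/-! ### Binomial series, Beta integrals and Euler's integral for F_D -/

theorem Gamma_add_natCast {a : ℝ} (ha : 0 < a) (k : ℕ) :
    Real.Gamma (a + k) = poch a k * Real.Gamma a := by
  induction k with
  | zero => simp [poch]
  | succ k ih =>
    rw [poch, ascPochhammer_succ_eval, ← poch, Nat.cast_succ, ← add_assoc,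
      Real.Gamma_add_one (by positivity), ih]
    ring

theorem poch_pos {a : ℝ} (ha : 0 < a) (k : ℕ) : 0 < poch a k :=
  ascPochhammer_pos k a ha

theorem hasSum_poch_rpow (b : ℝ) {x : ℝ} (hx : |x| < 1) :
    HasSum (fun k : ℕ => poch b k / (k.factorial : ℝ) * x ^ k) ((1 - x) ^ (-b)) := by
  have h := Real.one_div_one_sub_rpow_hasFPowerSeriesOnBall_zero b
  have h2 := h.hasSum (y := x) (by simpa [enorm_eq_nnnorm, ← NNReal.coe_lt_coe] using hx)
  have h1 : 0 < 1 - x := by linarith [(abs_lt.mp hx).2]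
  simp only [zero_add, FormalMultilinearSeries.ofScalars_apply_eq, smul_eq_mul] at h2
  rw [Real.rpow_neg h1.le, ← one_div]
  refine Eq.mp (congrArg (HasSum · _) (funext fun k => ?_)) h2
  have := Ring.factorial_nsmul_multichoose_eq_ascPochhammer b k
  rw [Polynomial.ascPochhammer_smeval_eq_eval, Ring.multichoose_eq, nsmul_eq_mul] at this
  rw [poch, ← this]
  field_simp

theorem summable_abs_poch (b : ℝ) {x : ℝ} (hx : |x| < 1) :
    Summable (fun k : ℕ => ‖poch b k / (k.factorial : ℝ) * x ^ k‖) :=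
  (hasSum_poch_rpow b hx).summable.norm

/-- Absolute convergence lets a product of two series be summed over pairs; induction on the number
of factors does the rest. The norm statement is carried along because the induction step needs it.
-/
theorem hasSum_pi_prod {d : ℕ} (g : Fin d → ℕ → ℝ) (hg : ∀ i, Summable fun k => ‖g i k‖) :
    (Summable fun m : Fin d → ℕ => ‖∏ i, g i (m i)‖) ∧
      HasSum (fun m : Fin d → ℕ => ∏ i, g i (m i)) (∏ i, ∑' k, g i k) := by
  induction d with
  | zero =>
    refine ⟨Summable.of_finite, ?_⟩
    simp [hasSum_unique]
  | succ d ih =>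
    obtain ⟨h1, h2⟩ := ih (fun i => g i.succ) fun i => hg i.succ
    have hs := summable_mul_of_summable_norm (hg 0) h1
    have hn := (hg 0).mul_norm h1
    have ht := (hg 0).of_norm.hasSum.mul h2 hs
    rw [Fin.prod_univ_succ]
    constructor
    · rw [← (Fin.consEquiv (fun _ : Fin (d + 1) => ℕ)).summable_iff]
      refine hn.congr fun p => ?_
      rw [Function.comp_apply, Fin.prod_univ_succ]
      rfl
    · rw [← (Fin.consEquiv (fun _ : Fin (d + 1) => ℕ)).hasSum_iff]
      refine Eq.mp (congrArg (HasSum · _) (funext fun p => ?_)) ht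
      rw [Function.comp_apply, Fin.prod_univ_succ]
      rfl

/-- Both claims are read off from the fact that the Beta density has total mass 1. -/
theorem beta_integral {p q : ℝ} (hp : 0 < p) (hq : 0 < q) :
    IntegrableOn (fun v : ℝ => v ^ (p - 1) * (1 - v) ^ (q - 1)) (Ioo 0 1) ∧
      ∫ v in Ioo (0 : ℝ) 1, v ^ (p - 1) * (1 - v) ^ (q - 1) =
        Real.Gamma p * Real.Gamma q / Real.Gamma (p + q) := by
  have hb := beta_pos hp hq
  have h := lintegral_betaPDF_eq_one hp hq
  rw [lintegral_betaPDF] at h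
  have h3 : ∀ v ∈ Ioo (0 : ℝ) 1, 0 ≤ 1 / beta p q * v ^ (p - 1) * (1 - v) ^ (q - 1) :=
    fun v hv => mul_nonneg (mul_nonneg (by positivity) (Real.rpow_nonneg hv.1.le _))
      (Real.rpow_nonneg (by linarith [hv.2]) _)
  have hm : Measurable fun v : ℝ => 1 / beta p q * v ^ (p - 1) * (1 - v) ^ (q - 1) := by fun_prop
  have hI : IntegrableOn (fun v : ℝ => 1 / beta p q * v ^ (p - 1) * (1 - v) ^ (q - 1))
      (Ioo 0 1) := by
    refine ⟨hm.aestronglyMeasurable, ?_⟩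
    rw [hasFiniteIntegral_iff_ofReal (ae_restrict_of_forall_mem measurableSet_Ioo h3), h]
    simp
  have e : (fun v : ℝ => v ^ (p - 1) * (1 - v) ^ (q - 1)) =
      fun v => beta p q * (1 / beta p q * v ^ (p - 1) * (1 - v) ^ (q - 1)) := by
    funext v; field_simp
  rw [e]
  refine ⟨hI.const_mul _, ?_⟩
  rw [integral_const_mul, integral_eq_lintegral_of_nonneg_ae
    (ae_restrict_of_forall_mem measurableSet_Ioo h3) hm.aestronglyMeasurable, h]
  simp [beta]

/-- Euler's integral representation of the Lauricella function `F_D`. -/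
theorem lauricella_euler {d : ℕ} {a c : ℝ} (ha : 0 < a) (hc : a < c) (b z : Fin d → ℝ)
    (hz : ∀ i, |z i| < 1) :
    Summable (lauricellaTerm a b c z) ∧
    IntegrableOn (fun v : ℝ => v ^ (a - 1) * (1 - v) ^ (c - a - 1) *
      ∏ i, (1 - v * z i) ^ (-b i)) (Ioo 0 1) ∧
    ∫ v in Ioo (0 : ℝ) 1, v ^ (a - 1) * (1 - v) ^ (c - a - 1) * ∏ i, (1 - v * z i) ^ (-b i) =
      Real.Gamma a * Real.Gamma (c - a) / Real.Gamma c * lauricellaFD a b c z := by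
  have hca : 0 < c - a := by linarith
  set w : (Fin d → ℕ) → ℝ := fun m => ∏ i, (poch (b i) (m i) / ((m i).factorial : ℝ) * z i ^ m i)
    with hw
  have hws : Summable fun m => ‖w m‖ :=
    (hasSum_pi_prod (fun i k => poch (b i) k / (k.factorial : ℝ) * z i ^ k)
      fun i => summable_abs_poch (b i) (hz i)).1
  set B := Real.Gamma a * Real.Gamma (c - a) / Real.Gamma c with hB
  have hBpos : 0 < B := by
    have := Real.Gamma_pos_of_pos ha
    have := Real.Gamma_pos_of_pos hca
    have := Real.Gamma_pos_of_pos (ha.trans hc)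
    positivity
  -- The binomial series of all factors (1 - v z_i)^(-b_i) are multiplied out, and the powers of v
  -- are collected so that each term is a Beta integral.
  let F : (Fin d → ℕ) → ℝ → ℝ := fun m v =>
    v ^ (a + (∑ i, m i : ℕ) - 1) * (1 - v) ^ (c - a - 1) * w m
  have hbi : ∀ m : Fin d → ℕ, _ := fun m =>
    beta_integral (p := a + (∑ i, m i : ℕ)) (q := c - a) (by positivity) hca
  have hFint : ∀ m, IntegrableOn (F m) (Ioo 0 1) := fun m => (hbi m).1.mul_const _
  have hFval : ∀ m, ∫ v in Ioo (0 : ℝ) 1, F m v = B * lauricellaTerm a b c z m := fun m => by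
    simp only [F]
    rw [integral_mul_const, (hbi m).2, Gamma_add_natCast ha,
      show a + ((∑ i, m i : ℕ) : ℝ) + (c - a) = c + (∑ i, m i : ℕ) by ring,
      Gamma_add_natCast (ha.trans hc), lauricellaTerm, hB, hw]
    simp only [Finset.prod_mul_distrib, Finset.prod_div_distrib]
    have := (poch_pos (ha.trans hc) (∑ i, m i)).ne'
    have := (Real.Gamma_pos_of_pos (ha.trans hc)).ne'
    have : ∏ i, ((m i).factorial : ℝ) ≠ 0 :=
      Finset.prod_ne_zero_iff.2 fun i _ => by positivity
    field_simp
  have h0 := beta_integral ha hca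
  -- On (0,1) the extra power of v is at most 1, so the case m = 0 dominates every term; this
  -- justifies termwise integration.
  have hFnorm : ∀ m, ∫ v in Ioo (0 : ℝ) 1, ‖F m v‖ ≤ B * ‖w m‖ := fun m => by
    rw [show B * ‖w m‖ = (∫ v in Ioo (0 : ℝ) 1, v ^ (a - 1) * (1 - v) ^ (c - a - 1)) * ‖w m‖ by
      rw [h0.2, add_sub_cancel], ← integral_mul_const]
    refine setIntegral_mono_on (hFint m).norm (h0.1.mul_const _) measurableSet_Ioo fun v hv => ?_
    have h1v : 0 < 1 - v := by linarith [hv.2]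
    simp only [F, norm_mul]
    rw [Real.norm_of_nonneg (Real.rpow_nonneg hv.1.le _),
      Real.norm_of_nonneg (Real.rpow_nonneg h1v.le _)]
    gcongr ?_ * _ * _
    exact Real.rpow_le_rpow_of_exponent_ge hv.1 hv.2.le
      (by have : (0 : ℝ) ≤ (∑ i, m i : ℕ) := by positivity
          linarith)
  have hsn : Summable fun m => ∫ v in Ioo (0 : ℝ) 1, ‖F m v‖ :=
    Summable.of_nonneg_of_le (fun m => integral_nonneg fun v => norm_nonneg _) hFnorm
      (hws.mul_left B)
  have key := hasSum_integral_of_summable_integral_norm hFint hsn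
  have hpt : ∀ v ∈ Ioo (0 : ℝ) 1, ∑' m, F m v =
      v ^ (a - 1) * (1 - v) ^ (c - a - 1) * ∏ i, (1 - v * z i) ^ (-b i) := fun v hv => by
    have hvz : ∀ i, |v * z i| < 1 := fun i => by
      rw [abs_mul, abs_of_pos hv.1]
      nlinarith [hz i, abs_nonneg (z i), hv.1, hv.2]
    have h := (hasSum_pi_prod (fun i k => poch (b i) k / (k.factorial : ℝ) * (v * z i) ^ k)
      fun i => summable_abs_poch (b i) (hvz i)).2
    simp only [fun i => (hasSum_poch_rpow (b i) (hvz i)).tsum_eq] at h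
    rw [← h.tsum_eq, ← tsum_mul_left]
    refine tsum_congr fun m => ?_
    simp only [F, hw, mul_pow, Finset.prod_mul_distrib]
    rw [Finset.prod_pow_eq_pow_sum, add_sub_right_comm, Real.rpow_add hv.1, Real.rpow_natCast]
    ring
  have hsum : Summable (lauricellaTerm a b c z) := by
    have := key.summable
    simp only [hFval] at this
    exact (summable_mul_left_iff hBpos.ne').1 this
  refine ⟨hsum, ?_, ?_⟩
  · refine h0.1.mul_continuousOn_of_subset (K := Icc 0 1) ?_ measurableSet_Ioo isCompact_Icc
      Ioo_subset_Icc_self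
    refine continuousOn_finsetProd _ fun i _ => ContinuousOn.rpow_const (by fun_prop) ?_
    refine fun v hv => Or.inl ?_
    nlinarith [(abs_lt.1 (hz i)).1, (abs_lt.1 (hz i)).2, hv.1, hv.2]
  · rw [← setIntegral_congr_fun measurableSet_Ioo hpt, ← key.tsum_eq]
    simp only [hFval]
    rw [tsum_mul_left, lauricellaFD]

theorem lauricella_lintegral {d : ℕ} {a c : ℝ} (ha : 0 < a) (hc : a < c) (b z : Fin d → ℝ)
    (hz : ∀ i, |z i| < 1) :
    ∫⁻ v in Ioo (0 : ℝ) 1, ENNReal.ofReal (v ^ (a - 1) * (1 - v) ^ (c - a - 1) *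
      ∏ i, (1 - v * z i) ^ (-b i)) =
      ENNReal.ofReal (Real.Gamma a * Real.Gamma (c - a) / Real.Gamma c *
        lauricellaFD a b c z) := by
  obtain ⟨-, h1, h2⟩ := lauricella_euler ha hc b z hz
  rw [← h2, ofReal_integral_eq_lintegral_ofReal h1]
  refine ae_restrict_of_forall_mem measurableSet_Ioo fun v hv => ?_
  refine mul_nonneg (mul_nonneg (Real.rpow_nonneg hv.1.le _)
    (Real.rpow_nonneg (by linarith [hv.2]) _))
    (Finset.prod_nonneg fun i _ => Real.rpow_nonneg ?_ _)
  nlinarith [(abs_lt.1 (hz i)).1, (abs_lt.1 (hz i)).2, hv.1, hv.2]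

/-! ### Integration over product spaces and affine changes of variable -/

theorem measurable_finCons {k : ℕ} :
    Measurable fun p : ℝ × (Fin k → ℝ) => (Fin.cons p.1 p.2 : Fin (k + 1) → ℝ) := by
  refine measurable_pi_iff.2 (Fin.cases ?_ fun j => ?_)
  · simpa using measurable_fst
  · simp only [Fin.cons_succ]; fun_prop

theorem measurable_finSnoc {k : ℕ} :
    Measurable fun p : ℝ × (Fin k → ℝ) => (Fin.snoc p.2 p.1 : Fin (k + 1) → ℝ) := by
  refine measurable_pi_iff.2 (Fin.lastCases ?_ fun j => ?_)
  · simpa using measurable_fst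
  · simp only [Fin.snoc_castSucc]; fun_prop

theorem lintegral_pi_cons {k : ℕ} (μ : Measure ℝ) [SigmaFinite μ] {G : (Fin (k + 1) → ℝ) → ENNReal}
    (hG : Measurable G) :
    ∫⁻ x, G x ∂(Measure.pi fun _ => μ) =
      ∫⁻ a, ∫⁻ y, G (Fin.cons a y : Fin (k + 1) → ℝ) ∂(Measure.pi fun _ => μ) ∂μ := by
  have h := measurePreserving_piFinSuccAbove (fun _ : Fin (k + 1) => μ) 0
  rw [← lintegral_prod (fun p : ℝ × (Fin k → ℝ) => G (Fin.cons p.1 p.2 : Fin (k + 1) → ℝ))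
    (hG.comp measurable_finCons).aemeasurable]
  refine Eq.trans (lintegral_congr fun x => ?_) (h.lintegral_comp (hG.comp measurable_finCons))
  congr 1
  exact (Fin.cons_self_tail x).symm

theorem lintegral_pi_snoc {k : ℕ} (μ : Measure ℝ) [SigmaFinite μ] {G : (Fin (k + 1) → ℝ) → ENNReal}
    (hG : Measurable G) :
    ∫⁻ x, G x ∂(Measure.pi fun _ => μ) =
      ∫⁻ a, ∫⁻ y, G (Fin.snoc y a : Fin (k + 1) → ℝ) ∂(Measure.pi fun _ => μ) ∂μ := by
  have h := measurePreserving_piFinSuccAbove (fun _ : Fin (k + 1) => μ) (Fin.last k)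
  rw [← lintegral_prod (fun p : ℝ × (Fin k → ℝ) => G (Fin.snoc p.2 p.1 : Fin (k + 1) → ℝ))
    (hG.comp measurable_finSnoc).aemeasurable]
  refine Eq.trans (lintegral_congr fun x => ?_) (h.lintegral_comp (hG.comp measurable_finSnoc))
  congr 1
  simp [MeasurableEquiv.piFinSuccAbove, Fin.insertNthEquiv, Fin.removeNth_last]

theorem lintegral_pi_withDensity {f : ℝ → ENNReal} (hf : Measurable f)
    [SigmaFinite (volume.withDensity f)] {k : ℕ} {G : (Fin k → ℝ) → ENNReal} (hG : Measurable G) :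
    ∫⁻ x, G x ∂(Measure.pi fun _ => volume.withDensity f) = ∫⁻ x, (∏ i, f (x i)) * G x := by
  induction k with
  | zero => simp [volume_pi, Measure.pi_of_empty (α := Fin 0)]
  | succ k ih =>
    rw [lintegral_pi_cons _ hG, volume_pi, lintegral_pi_cons _ (by fun_prop)]
    have hGc := hG.comp (measurable_finCons (k := k))
    have hGa : ∀ a, Measurable fun y => G (Fin.cons a y : Fin (k + 1) → ℝ) := fun a =>
      hGc.comp measurable_prodMk_left
    simp only [fun a => ih (hGa a)]
    rw [lintegral_withDensity_eq_lintegral_mul _ hf]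
    · refine lintegral_congr fun a => ?_
      rw [Pi.mul_apply, ← lintegral_const_mul _ (by have := hGa a; fun_prop), volume_pi]
      refine lintegral_congr fun y => ?_
      simp [Fin.prod_univ_succ, mul_assoc]
    · refine Measurable.lintegral_prod_right'
        (f := fun p : ℝ × (Fin k → ℝ) => (∏ i, f (p.2 i)) * G (Fin.cons p.1 p.2)) ?_
      exact Measurable.mul (by fun_prop) hGc

/-- Scaling is a homeomorphism, hence a measurable equivalence, so `g` may be arbitrary. -/
theorem lintegral_affine {E : Type*} [NormedAddCommGroup E] [NormedSpace ℝ E] [MeasurableSpace E]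
    [BorelSpace E] [FiniteDimensional ℝ E] (μ : Measure E) [μ.IsAddHaarMeasure] (b : E) {r : ℝ}
    (hr : r ≠ 0) (g : E → ENNReal) :
    ∫⁻ y, g y ∂μ = ENNReal.ofReal (|r| ^ Module.finrank ℝ E) * ∫⁻ t, g (b + r • t) ∂μ := by
  have h := lintegral_map_equiv (μ := μ) (fun y : E => g (b + y))
    (Homeomorph.smul (isUnit_iff_ne_zero.2 hr).unit).toMeasurableEquiv
  have h2 : ∫⁻ t, g (b + r • t) ∂μ =
      ENNReal.ofReal (|(r ^ Module.finrank ℝ E)⁻¹|) * ∫⁻ y, g y ∂μ := by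
    rw [← lintegral_add_left_eq_self g b, ← smul_eq_mul, ← lintegral_smul_measure,
      ← Measure.map_addHaar_smul μ hr]
    exact h.symm
  rw [h2, ← mul_assoc, ← ENNReal.ofReal_mul (by positivity), abs_inv, abs_pow,
    mul_inv_cancel₀ (by positivity), ENNReal.ofReal_one, one_mul]

/-! ### Order statistics -/

/-- Ties lie in finitely many hyperplanes x_i = x_j, which are proper subspaces and therefore null.
-/
theorem ae_injective (k : ℕ) : ∀ᵐ x : Fin k → ℝ, Function.Injective x := by
  have h : ∀ i j : Fin k, ∀ᵐ x : Fin k → ℝ, i ≠ j → x i ≠ x j := fun i j => by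
    by_cases hij : i = j
    · simp [hij]
    · have := Measure.addHaar_submodule (volume : Measure (Fin k → ℝ))
        (LinearMap.ker ((LinearMap.proj i : (Fin k → ℝ) →ₗ[ℝ] ℝ) - LinearMap.proj j)) (by
          intro h
          have : (Pi.single i 1 : Fin k → ℝ) ∈
            LinearMap.ker ((LinearMap.proj i : (Fin k → ℝ) →ₗ[ℝ] ℝ) - LinearMap.proj j) := by
            rw [h]; trivial
          simp [Ne.symm hij] at this)
      refine measure_mono_null ?_ this
      intro x hx
      simpa [hij, sub_eq_zero] using hx
  filter_upwards [ae_all_iff.2 fun i => ae_all_iff.2 (h i)] with x hx i j hij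
  by_contra hne
  exact hx i j hne hij

theorem measurableSet_monotone (k : ℕ) : MeasurableSet {x : Fin k → ℝ | Monotone x} :=
  isClosed_monotone.measurableSet

theorem measurable_comp_perm {k : ℕ} (τ : Equiv.Perm (Fin k)) :
    Measurable fun x : Fin k → ℝ => x ∘ τ :=
  measurable_pi_iff.2 fun i => measurable_pi_apply (τ i)

/-- All monotone rearrangements of a tuple coincide, so a preimage is a finite union over
permutations and the tie-breaking of `Tuple.sort` plays no role. -/
theorem measurable_ordered {k : ℕ} : Measurable (ordered : (Fin k → ℝ) → Fin k → ℝ) := by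
  intro B hB
  have : ordered ⁻¹' B = ⋃ τ : Equiv.Perm (Fin k),
      (fun x : Fin k → ℝ => x ∘ τ) ⁻¹' ({x | Monotone x} ∩ B) := by
    ext x
    simp only [mem_preimage, mem_iUnion, mem_inter_iff, mem_ofPred_eq]
    refine ⟨fun h => ⟨Tuple.sort x, Tuple.monotone_sort x, h⟩, ?_⟩
    rintro ⟨τ, h1, h2⟩
    rwa [ordered, ← Tuple.comp_sort_eq_comp_iff_monotone.2 h1]
  rw [this]
  exact MeasurableSet.iUnion fun τ =>
    measurable_comp_perm τ ((measurableSet_monotone k).inter hB)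

theorem ordered_of_monotone {k : ℕ} {x : Fin k → ℝ} (hx : Monotone x) : ordered x = x := by
  rw [ordered, Tuple.sort_eq_refl_iff_monotone.2 hx]
  rfl

theorem monotone_ordered {k : ℕ} (x : Fin k → ℝ) : Monotone (ordered x) :=
  Tuple.monotone_sort x

/-- Without ties exactly one permutation sorts the tuple, and each permutation of coordinates
preserves volume. -/
theorem lintegral_ordered {k : ℕ} {G : (Fin k → ℝ) → ENNReal} (hG : Measurable G) :
    ∫⁻ x, G (ordered x) = k.factorial * ∫⁻ x in {x | Monotone x}, G x := by
  have hm := measurableSet_monotone k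
  set H : (Fin k → ℝ) → ENNReal := {x | Monotone x}.indicator G with hH
  have hHm : Measurable H := hG.indicator hm
  have h1 : ∀ᵐ x : Fin k → ℝ, G (ordered x) = ∑ τ : Equiv.Perm (Fin k), H (x ∘ τ) := by
    filter_upwards [ae_injective k] with x hx
    rw [Finset.sum_eq_single_of_mem (Tuple.sort x) (Finset.mem_univ _)]
    · exact (indicator_of_mem (monotone_ordered x) G).symm
    · intro τ _ hτ
      refine indicator_of_notMem (fun hmono => hτ ?_) _
      have := Tuple.comp_sort_eq_comp_iff_monotone.2 hmono
      exact Equiv.ext fun i => hx (congrFun this i)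
  rw [lintegral_congr_ae h1]
  have h2 : ∀ τ : Equiv.Perm (Fin k), ∫⁻ x : Fin k → ℝ, H (x ∘ τ) = ∫⁻ x, H x := fun τ => by
    have h := volume_preserving_arrowCongr' τ.symm (MeasurableEquiv.refl ℝ) (.id _)
    rw [← h.lintegral_comp hHm]
    rfl
  refine (lintegral_finsetSum _ fun τ _ => hHm.comp (measurable_comp_perm τ)).trans ?_
  refine (Finset.sum_congr rfl fun τ _ => h2 τ).trans ?_
  rw [Finset.sum_const, hH, lintegral_indicator hm, Finset.card_univ, Fintype.card_perm,
    Fintype.card_fin, nsmul_eq_mul]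

/-! ### Samples in terms of minimum, range and normalised middle points -/

/-- The sample with least entry `m`, range `r` and normalised middle entries `t`. -/
def sampleOf {n : ℕ} (m r : ℝ) (t : Fin (n + 1) → ℝ) : Fin (n + 3) → ℝ :=
  Fin.cons m (Fin.snoc (fun j => m + r * t j) (m + r) : Fin (n + 2) → ℝ)

section
variable {n : ℕ} (m r : ℝ) (t : Fin (n + 1) → ℝ)

@[simp] theorem sampleOf_zero : sampleOf m r t 0 = m := rfl

@[simp] theorem sampleOf_last : sampleOf m r t (Fin.last (n + 2)) = m + r := by
  rw [sampleOf, ← Fin.succ_last, Fin.cons_succ, Fin.snoc_last]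

@[simp] theorem sampleOf_mid (j : Fin (n + 1)) :
    sampleOf m r t j.succ.castSucc = m + r * t j := by
  rw [sampleOf, ← Fin.succ_castSucc, Fin.cons_succ, Fin.snoc_castSucc]

theorem prod_sampleOf {M : Type*} [CommMonoid M] (f : ℝ → M) :
    ∏ i, f (sampleOf m r t i) = f m * ((∏ j, f (m + r * t j)) * f (m + r)) := by
  simp [sampleOf, Fin.prod_univ_succ (n := n + 2), Fin.prod_univ_castSucc (n := n + 1)]

/-- The largest entry is only translated by m, at no cost; each of the n + 1 middle entries is
scaled by r. -/
theorem lintegral_sampleOf {G : (Fin (n + 3) → ℝ) → ENNReal} (hG : Measurable G) :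
    ∫⁻ x, G x = ∫⁻ m, ∫⁻ r, ∫⁻ t : Fin (n + 1) → ℝ,
      ENNReal.ofReal (|r| ^ (n + 1)) * G (sampleOf m r t) := by
  rw [volume_pi, lintegral_pi_cons _ hG]
  refine lintegral_congr fun m => ?_
  have hGm : Measurable fun y : Fin (n + 2) → ℝ => G (Fin.cons m y : Fin (n + 3) → ℝ) :=
    (hG.comp measurable_finCons).comp measurable_prodMk_left
  rw [lintegral_pi_snoc _ hGm, ← lintegral_add_left_eq_self _ m]
  refine lintegral_congr_ae ?_
  filter_upwards [Measure.ae_ne volume 0] with r hr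
  rw [← volume_pi, lintegral_affine volume (fun _ => m) hr, Module.finrank_fin_fun,
    lintegral_const_mul' _ _ ENNReal.ofReal_ne_top]
  rfl

theorem monotone_sampleOf_iff (hr : r ≠ 0) :
    Monotone (sampleOf m r t) ↔ 0 < r ∧ t ∈ admissible n := by
  constructor
  · intro h
    have hr' : 0 < r := by
      have := h (Fin.zero_le (Fin.last (n + 2)))
      simp only [sampleOf_zero, sampleOf_last] at this
      exact lt_of_le_of_ne (by linarith) hr.symm
    refine ⟨hr', fun i j hij => ?_, fun j => ⟨?_, ?_⟩⟩
    · have := h (Fin.castSucc_le_castSucc_iff.2 (Fin.succ_le_succ_iff.2 hij))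
      simp only [sampleOf_mid] at this
      nlinarith
    · have := h (Fin.zero_le j.succ.castSucc)
      simp only [sampleOf_mid, sampleOf_zero] at this
      nlinarith
    · have := h (Fin.le_last j.succ.castSucc)
      simp only [sampleOf_mid, sampleOf_last] at this
      nlinarith
  · rintro ⟨hr', hmono, hIcc⟩
    intro i j
    induction i using Fin.cases with
    | zero =>
      intro _
      induction j using Fin.lastCases with
      | last => simp [hr'.le]
      | cast j =>
        induction j using Fin.cases with
        | zero => exact le_rfl
        | succ j =>
          rw [sampleOf_mid, sampleOf_zero]
          nlinarith [(hIcc j).1]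
    | succ i =>
      induction j using Fin.cases with
      | zero => intro h; simp at h
      | succ j =>
        intro h
        rw [Fin.succ_le_succ_iff] at h
        induction j using Fin.lastCases with
        | last =>
          induction i using Fin.lastCases with
          | last => exact le_rfl
          | cast i =>
            rw [Fin.succ_castSucc, Fin.succ_last, sampleOf_mid, sampleOf_last]
            nlinarith [(hIcc i).2]
        | cast j =>
          induction i using Fin.lastCases with
          | last => exact absurd h (by simp)
          | cast i =>
            rw [Fin.succ_castSucc, Fin.succ_castSucc, sampleOf_mid, sampleOf_mid]
            have := hmono (Fin.castSucc_le_castSucc_iff.1 h)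
            nlinarith

end

theorem normData_ordered {n : ℕ} (x : Fin (n + 3) → ℝ) : normData (ordered x) = normData x := by
  unfold normData
  rw [ordered_of_monotone (monotone_ordered x)]

theorem normData_sampleOf {n : ℕ} {m r : ℝ} {t : Fin (n + 1) → ℝ} (hr : r ≠ 0)
    (h : Monotone (sampleOf m r t)) : normData (sampleOf m r t) = t := by
  funext j
  rw [normData, ordered_of_monotone h, sampleOf_mid, sampleOf_zero, sampleOf_last,
    add_sub_cancel_left, add_sub_cancel_left, mul_div_cancel_left₀ _ hr]

theorem normPoint_sampleOf {n : ℕ} {m r : ℝ} {t : Fin (n + 1) → ℝ}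
    (h : Monotone (sampleOf m r t)) (y : ℝ) : normPoint (sampleOf m r t) y = (y - m) / r := by
  simp [normPoint, ordered_of_monotone h]

theorem measurable_normData {n : ℕ} : Measurable (normData (n := n)) := by
  have := measurable_ordered (k := n + 3)
  unfold normData
  fun_prop

theorem measurable_normPoint {n : ℕ} :
    Measurable fun p : (Fin (n + 3) → ℝ) × ℝ => normPoint p.1 p.2 := by
  have := measurable_ordered (k := n + 3)
  unfold normPoint
  fun_prop

theorem measurable_normPair {n : ℕ} : Measurable (normPair (n := n)) := by
  have h : Measurable fun x : Fin (n + 4) → ℝ => (Fin.init x : Fin (n + 3) → ℝ) :=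
    measurable_pi_iff.2 fun i => measurable_pi_apply _
  exact (measurable_normData.comp h).prodMk
    (measurable_normPoint.comp (h.prodMk (measurable_pi_apply _)))

theorem normData_mem_admissible {n : ℕ} (x : Fin (n + 3) → ℝ) : normData x ∈ admissible n := by
  have h := monotone_ordered x
  have h0 : 0 ≤ ordered x (Fin.last (n + 2)) - ordered x 0 := sub_nonneg.2 (h (Fin.zero_le _))
  refine ⟨fun i j hij => ?_, fun j => ⟨?_, ?_⟩⟩
  · have := h (Fin.castSucc_le_castSucc_iff.2 (Fin.succ_le_succ_iff.2 hij))
    unfold normData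
    gcongr
  · exact div_nonneg (sub_nonneg.2 (h (Fin.zero_le _))) h0
  · exact div_le_one_of_le₀ (sub_le_sub_right (h (Fin.le_last _)) _) h0

theorem measurableSet_admissible (n : ℕ) : MeasurableSet (admissible n) := by
  have : admissible n = {t | Monotone t} ∩ ⋂ j, (fun t => t j) ⁻¹' Icc (0 : ℝ) 1 := by
    ext t; simp [admissible]
  rw [this]
  exact (measurableSet_monotone _).inter
    (MeasurableSet.iInter fun j => measurable_pi_apply j measurableSet_Icc)

/-! ### The joint density of (t, s) -/

/-- The integrand, in the least entry `m` and the range `r` of a sample from the density `f`, of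
the joint density at `(t, s)`. -/
def jointKernel {n : ℕ} (f : ℝ → ENNReal) (t : Fin (n + 1) → ℝ) (s m r : ℝ) : ENNReal :=
  ENNReal.ofReal (r ^ (n + 2)) *
    ((f m * ((∏ j, f (m + r * t j)) * f (m + r))) * f (m + r * s))

/-- The joint density of the normalised data and a further normalised point. -/
def jointDensity {n : ℕ} (f : ℝ → ENNReal) (p : (Fin (n + 1) → ℝ) × ℝ) : ENNReal :=
  (admissible n ×ˢ univ).indicator
    (fun p => ((n + 3).factorial : ENNReal) *
      ∫⁻ m, ∫⁻ r in Ioi (0 : ℝ), jointKernel f p.1 p.2 m r) p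

theorem measurable_jointKernel {n : ℕ} {f : ℝ → ENNReal} (hf : Measurable f) :
    Measurable fun q : (((Fin (n + 1) → ℝ) × ℝ) × ℝ) × ℝ =>
      jointKernel f q.1.1.1 q.1.1.2 q.1.2 q.2 := by
  unfold jointKernel
  fun_prop

theorem measurable_jointDensity {n : ℕ} {f : ℝ → ENNReal} (hf : Measurable f) :
    Measurable (jointDensity (n := n) f) := by
  refine Measurable.indicator (Measurable.const_mul ?_ _)
    ((measurableSet_admissible n).prod MeasurableSet.univ)
  exact Measurable.lintegral_prod_right' (Measurable.lintegral_prod_right'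
    (measurable_jointKernel hf))

theorem map_normPair {n : ℕ} {f : ℝ → ENNReal} (hf : Measurable f)
    [SigmaFinite (volume.withDensity f)] :
    (Measure.pi fun _ : Fin (n + 4) => volume.withDensity f).map normPair =
      volume.withDensity (jointDensity f) := by
  refine Measure.ext_of_lintegral _ fun g hg => ?_
  rw [lintegral_map hg measurable_normPair,
    lintegral_pi_withDensity (G := fun x => g (normPair x)) hf (hg.comp measurable_normPair),
    lintegral_withDensity_eq_lintegral_mul _ (measurable_jointDensity hf) hg]
  have hG0 : Measurable fun p : (Fin (n + 3) → ℝ) × ℝ =>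
      ((∏ i, f (p.1 i)) * f p.2) * g (normData p.1, normPoint p.1 p.2) := by
    refine Measurable.mul (by fun_prop) (hg.comp ?_)
    exact (measurable_normData.comp measurable_fst).prodMk measurable_normPoint
  set G : (Fin (n + 3) → ℝ) → ENNReal := fun x =>
    ∫⁻ y, ((∏ i, f (x i)) * f y) * g (normData x, normPoint x y) with hG
  have hGm : Measurable G := hG0.lintegral_prod_right'
  -- The normalised data and the product of densities depend on the sample only through its order
  -- statistics.
  have hGo : ∀ x, G x = G (ordered x) := fun x => by
    simp only [hG, normData_ordered, normPoint, ordered_of_monotone (monotone_ordered x)]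
    rw [show ∏ i, f (ordered x i) = ∏ i, f (x i) from
      Equiv.prod_comp (Tuple.sort x) fun i => f (x i)]
  have e1 : ∫⁻ x : Fin (n + 4) → ℝ, (∏ i, f (x i)) * g (normPair x) = ∫⁻ x, G x := by
    have hm : Measurable fun x : Fin (n + 4) → ℝ => (∏ i, f (x i)) * g (normPair x) :=
      Measurable.mul (by fun_prop) (hg.comp measurable_normPair)
    rw [volume_pi, lintegral_pi_snoc _ hm, ← volume_pi, lintegral_lintegral_swap]
    · simp [hG, Fin.prod_univ_castSucc (n := n + 3), normPair]
    · exact (hm.comp measurable_finSnoc).aemeasurable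
  rw [e1, lintegral_congr hGo, lintegral_ordered hGm, ← lintegral_indicator
    (measurableSet_monotone _), lintegral_sampleOf (hGm.indicator (measurableSet_monotone _))]
  have e2 : ∀ m : ℝ, ∀ r : ℝ, r ≠ 0 → ∀ t : Fin (n + 1) → ℝ,
      ENNReal.ofReal (|r| ^ (n + 1)) * {x | Monotone x}.indicator G (sampleOf m r t) =
      (Ioi (0 : ℝ)).indicator (fun r => ∫⁻ s, (admissible n ×ˢ univ).indicator
        (fun p => jointKernel f p.1 p.2 m r * g p) (t, s)) r := fun m r hr t => by
    by_cases h : Monotone (sampleOf m r t)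
    · obtain ⟨h1, h2⟩ := (monotone_sampleOf_iff m r t hr).1 h
      rw [indicator_of_mem (show r ∈ Ioi (0 : ℝ) from h1),
        indicator_of_mem (show sampleOf m r t ∈ {x | Monotone x} from h)]
      simp only [hG, normData_sampleOf hr h, normPoint_sampleOf h, prod_sampleOf]
      -- Substituting y = m + rs supplies the last power of r in `jointKernel`.
      rw [lintegral_affine volume m hr, Module.finrank_self, pow_one, abs_of_pos h1, ← mul_assoc,
        ← ENNReal.ofReal_mul (by positivity), ← pow_succ,
        ← lintegral_const_mul' _ _ ENNReal.ofReal_ne_top]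
      refine lintegral_congr fun s => ?_
      rw [indicator_of_mem (show (t, s) ∈ admissible n ×ˢ univ from ⟨h2, trivial⟩)]
      simp only [smul_eq_mul, add_sub_cancel_left, mul_div_cancel_left₀ _ hr, jointKernel]
      simp only [mul_assoc]
    · rw [indicator_of_notMem (show sampleOf m r t ∉ {x | Monotone x} from h), mul_zero]
      by_cases h1 : 0 < r
      · have h2 : t ∉ admissible n := fun h2 => h ((monotone_sampleOf_iff m r t hr).2 ⟨h1, h2⟩)
        simp [h2]
      · simp [h1]
  set Φ : ℝ → ℝ → (Fin (n + 1) → ℝ) × ℝ → ENNReal := fun m r =>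
    (admissible n ×ˢ univ).indicator fun p => jointKernel f p.1 p.2 m r * g p with hΦ
  have hΦm : Measurable fun q : (((Fin (n + 1) → ℝ) × ℝ) × ℝ) × ℝ => Φ q.1.2 q.2 q.1.1 := by
    have h : MeasurableSet {q : (((Fin (n + 1) → ℝ) × ℝ) × ℝ) × ℝ |
        q.1.1 ∈ admissible n ×ˢ (univ : Set ℝ)} :=
      (measurable_fst.comp measurable_fst)
        ((measurableSet_admissible n).prod MeasurableSet.univ)
    exact ((measurable_jointKernel hf).mul
      (hg.comp (measurable_fst.comp measurable_fst))).indicator h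
  have hΦp : ∀ m r, Measurable (Φ m r) := fun m r =>
    hΦm.comp (f := fun p => ((p, m), r)) (by fun_prop)
  have e3 : ∀ p, (jointDensity (n := n) f * g) p =
      ((n + 3).factorial : ENNReal) * ∫⁻ m, ∫⁻ r in Ioi (0 : ℝ), Φ m r p := fun p => by
    by_cases hp : p ∈ admissible n ×ˢ (univ : Set ℝ)
    · simp only [hΦ, Pi.mul_apply, jointDensity, indicator_of_mem hp]
      have hp2 : Measurable fun q : ℝ × ℝ => jointKernel f p.1 p.2 q.1 q.2 :=
        (measurable_jointKernel hf).comp (f := fun q : ℝ × ℝ => ((p, q.1), q.2)) (by fun_prop)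
      rw [mul_assoc, ← lintegral_mul_const _ hp2.lintegral_prod_right']
      congr 1
      refine lintegral_congr fun m => ?_
      exact (lintegral_mul_const _ (hp2.comp measurable_prodMk_left)).symm
    · simp [hΦ, jointDensity, indicator_of_notMem hp]
  have hN : ((n + 3).factorial : ENNReal) ≠ ⊤ := ENNReal.natCast_ne_top _
  rw [lintegral_congr e3, lintegral_const_mul' _ _ hN]
  congr 1
  rw [lintegral_lintegral_swap (f := fun p m => ∫⁻ r in Ioi (0 : ℝ), Φ m r p)
    hΦm.lintegral_prod_right'.aemeasurable]
  refine lintegral_congr fun m => ?_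
  rw [lintegral_lintegral_swap (f := fun p r => Φ m r p)
    (hΦm.comp (f := fun q : ((Fin (n + 1) → ℝ) × ℝ) × ℝ => ((q.1, m), q.2))
      (by fun_prop)).aemeasurable, ← lintegral_indicator measurableSet_Ioi]
  refine lintegral_congr_ae ?_
  filter_upwards [Measure.ae_ne volume 0] with r hr
  rw [lintegral_congr (e2 m r hr)]
  by_cases h : r ∈ Ioi (0 : ℝ)
  · simp only [indicator_of_mem h]
    exact (lintegral_prod _ (hΦp m r).aemeasurable).symm
  · simp [indicator_of_notMem h]

/-! ### The Generalised Pareto law: moments, survival function, threshold stability -/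

/-- Written with |p| so that it has the same value as `lintegral_Ioo_rpow`, and both signs of ξ
share one computation. -/
theorem lintegral_Ioi_rpow {p c : ℝ} (hp : p < 0) (hc : 0 < c) :
    ∫⁻ y in Ioi c, ENNReal.ofReal (y ^ (p - 1)) = ENNReal.ofReal (c ^ p / |p|) := by
  rw [← ofReal_integral_eq_lintegral_ofReal (integrableOn_Ioi_rpow_of_lt (by linarith) hc)
    (ae_restrict_of_forall_mem measurableSet_Ioi fun y hy => Real.rpow_nonneg (hc.trans hy).le _),
    integral_Ioi_rpow_of_lt (by linarith) hc, sub_add_cancel, abs_of_neg hp, neg_div, div_neg]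

theorem lintegral_Ioo_rpow {p c : ℝ} (hp : 0 < p) (hc : 0 < c) :
    ∫⁻ y in Ioo 0 c, ENNReal.ofReal (y ^ (p - 1)) = ENNReal.ofReal (c ^ p / |p|) := by
  have h := intervalIntegral.intervalIntegrable_rpow' (a := 0) (b := c) (r := p - 1) (by linarith)
  rw [← ofReal_integral_eq_lintegral_ofReal
    (((intervalIntegrable_iff_integrableOn_Ioc_of_le hc.le).1 h).mono_set Ioo_subset_Ioc_self)
    (ae_restrict_of_forall_mem measurableSet_Ioo fun y hy => Real.rpow_nonneg hy.1.le _),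
    ← integral_Ioc_eq_integral_Ioo, ← intervalIntegral.integral_of_le hc.le,
    integral_rpow (Or.inl (by linarith)), sub_add_cancel, abs_of_pos hp, Real.zero_rpow hp.ne',
    sub_zero]

theorem measurable_gpdPDF (μ σ ξ : ℝ) : Measurable (gpdPDF μ σ ξ) := by
  have h1 : MeasurableSet {x : ℝ | μ < x} := measurableSet_Ioi
  have h2 : MeasurableSet {x : ℝ | μ < x ∧ 0 < 1 + ξ * ((x - μ) / σ)} :=

    h1.inter (measurableSet_lt (f := fun _ => (0 : ℝ)) (g := fun x => 1 + ξ * ((x - μ) / σ))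
      measurable_const (by fun_prop))
  unfold gpdPDF
  split_ifs
  · exact Measurable.ite h1 (by fun_prop) measurable_const
  · exact Measurable.ite h2 (by fun_prop) measurable_const

theorem gpdPDF_nonneg {μ σ : ℝ} (hσ : 0 < σ) (ξ x : ℝ) : 0 ≤ gpdPDF μ σ ξ x := by
  unfold gpdPDF
  split_ifs with _ _ h
  · positivity
  · exact le_rfl
  · exact mul_nonneg (by positivity) (Real.rpow_nonneg h.2.le _)
  · exact le_rfl

/-- Moments of the survival function of the Generalised Pareto Distribution against its density,
above a threshold `c`. -/
theorem lintegral_gpdPDF_mul_rpow {μ σ ξ c κ : ℝ} (hσ : 0 < σ) (hξ : ξ ≠ 0) (hc : μ ≤ c)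
    (hy : 0 < 1 + ξ * ((c - μ) / σ)) (hκ : 0 ≤ κ) :
    ∫⁻ x in Ioi c, ENNReal.ofReal
      (gpdPDF μ σ ξ x * (1 + ξ * ((x - μ) / σ)) ^ (-(κ / ξ))) =
      ENNReal.ofReal ((1 + ξ * ((c - μ) / σ)) ^ (-((κ + 1) / ξ)) / (κ + 1)) := by
  have hr : σ / ξ ≠ 0 := div_ne_zero hσ.ne' hξ
  set p : ℝ := -((κ + 1) / ξ) with hp
  set Y := 1 + ξ * ((c - μ) / σ) with hY
  have hval : |σ / ξ| * (σ⁻¹ * (Y ^ p / |p|)) = Y ^ p / (κ + 1) := by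
    have h1 : |p| = (κ + 1) / |ξ| := by
      rw [hp, abs_neg, abs_div, abs_of_pos (by linarith : (0 : ℝ) < κ + 1)]
    have : |ξ| ≠ 0 := abs_ne_zero.2 hξ
    rw [h1, abs_div, abs_of_pos hσ]
    field_simp
  rw [← lintegral_indicator measurableSet_Ioi,
    lintegral_affine volume (μ - σ / ξ) hr, Module.finrank_self, pow_one]
  -- The new variable is y = 1 + ξ(x - μ)/σ. The range x > c becomes y > Y for ξ > 0, and 0 < y < Y
  -- for ξ < 0.
  have hyy : ∀ y : ℝ, 1 + ξ * ((μ - σ / ξ + (σ / ξ) • y - μ) / σ) = y := fun y => by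
    rw [smul_eq_mul]; field_simp; ring
  have hpt : ∀ y : ℝ, (Ioi c).indicator (fun x => ENNReal.ofReal
      (gpdPDF μ σ ξ x * (1 + ξ * ((x - μ) / σ)) ^ (-(κ / ξ)))) (μ - σ / ξ + (σ / ξ) • y) =
      {y | 0 < y ∧ c < μ - σ / ξ + (σ / ξ) • y}.indicator
        (fun y => ENNReal.ofReal σ⁻¹ * ENNReal.ofReal (y ^ (p - 1))) y := fun y => by
    by_cases h1 : c < μ - σ / ξ + (σ / ξ) • y
    · rw [indicator_of_mem (show _ ∈ Ioi c from h1), gpdPDF, if_neg hξ, hyy]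
      by_cases h2 : 0 < y
      · rw [if_pos ⟨hc.trans_lt h1, h2⟩, indicator_of_mem (show y ∈ {y | 0 < y ∧ c < μ - σ / ξ + (σ / ξ) • y} from ⟨h2, h1⟩),
          ← ENNReal.ofReal_mul (by positivity), mul_assoc, ← Real.rpow_add h2]
        congr 3
        rw [hp]; ring
      · rw [if_neg fun h => h2 h.2, indicator_of_notMem fun h => h2 h.1]
        simp
    · rw [indicator_of_notMem (show _ ∉ Ioi c from h1), indicator_of_notMem fun h => h1 h.2]
  rw [lintegral_congr hpt]
  have hcY : c = μ - σ / ξ + (σ / ξ) * Y := by rw [hY]; field_simp; ring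
  have main : ∀ s : Set ℝ, MeasurableSet s → {y | 0 < y ∧ c < μ - σ / ξ + (σ / ξ) • y} = s →
      ∫⁻ y in s, ENNReal.ofReal (y ^ (p - 1)) = ENNReal.ofReal (Y ^ p / |p|) →
      ENNReal.ofReal |σ / ξ| * ∫⁻ y, {y | 0 < y ∧ c < μ - σ / ξ + (σ / ξ) • y}.indicator
        (fun y => ENNReal.ofReal σ⁻¹ * ENNReal.ofReal (y ^ (p - 1))) y =
        ENNReal.ofReal (Y ^ p / (κ + 1)) := by
    intro s hs hse hint
    rw [hse, lintegral_indicator hs, lintegral_const_mul' _ _ ENNReal.ofReal_ne_top, hint,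
      ← ENNReal.ofReal_mul (by positivity), ← ENNReal.ofReal_mul (by positivity), hval]
  rcases hξ.lt_or_gt with hneg | hpos
  · have hr' : σ / ξ < 0 := div_neg_of_pos_of_neg hσ hneg
    refine main (Ioo 0 Y) measurableSet_Ioo ?_ (lintegral_Ioo_rpow ?_ hy)
    · ext y
      refine and_congr_right fun _ => ?_
      rw [smul_eq_mul]
      constructor <;> intro h <;> nlinarith
    · rw [hp, ← div_neg]; exact div_pos (by linarith) (by linarith)
  · have hr' : 0 < σ / ξ := div_pos hσ hpos
    refine main (Ioi Y) measurableSet_Ioi ?_ (lintegral_Ioi_rpow ?_ hy)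
    · ext y
      simp only [mem_ofPred_eq, smul_eq_mul, mem_Ioi]
      constructor
      · rintro ⟨_, h⟩; nlinarith
      · intro h; exact ⟨hy.trans h, by nlinarith⟩
    · rw [hp]; exact neg_neg_of_pos (div_pos (by linarith) hpos)

/-- The power `x ^ a` for `x > 0`, and `0` otherwise. -/
def posPow (x a : ℝ) : ℝ := if 0 < x then x ^ a else 0

theorem posPow_nonneg (x a : ℝ) : 0 ≤ posPow x a := by
  unfold posPow
  split_ifs with h
  · exact Real.rpow_nonneg h.le _
  · exact le_rfl

theorem posPow_of_pos {x : ℝ} (hx : 0 < x) (a : ℝ) : posPow x a = x ^ a := if_pos hx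

theorem posPow_of_nonpos {x : ℝ} (hx : x ≤ 0) (a : ℝ) : posPow x a = 0 := if_neg hx.not_gt

/-- Survival function of the Generalised Pareto Distribution. -/
theorem lintegral_gpdPDF_Ioi {μ σ ξ c : ℝ} (hσ : 0 < σ) (hξ : ξ ≠ 0) (hc : μ ≤ c) :
    ∫⁻ x in Ioi c, ENNReal.ofReal (gpdPDF μ σ ξ x) =
      ENNReal.ofReal (posPow (1 + ξ * ((c - μ) / σ)) (-(1 / ξ))) := by
  by_cases hy : 0 < 1 + ξ * ((c - μ) / σ)
  · have := lintegral_gpdPDF_mul_rpow (κ := 0) hσ hξ hc hy le_rfl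
    simpa [posPow_of_pos hy] using this
  -- Here c is at or beyond the upper endpoint of the support, which forces ξ < 0.
  · rw [posPow_of_nonpos (not_lt.1 hy), ENNReal.ofReal_zero]
    refine setLIntegral_eq_zero measurableSet_Ioi fun x hx => ?_
    have hξ' : ξ < 0 := by
      by_contra h
      have : 0 ≤ ξ * ((c - μ) / σ) :=
        mul_nonneg (not_lt.1 h) (div_nonneg (by linarith) hσ.le)
      linarith
    have h : ¬ 0 < 1 + ξ * ((x - μ) / σ) := by
      have : (c - μ) / σ ≤ (x - μ) / σ := by
        have : c ≤ x := le_of_lt hx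
        gcongr
      nlinarith
    simp [gpdPDF, hξ, h]

/-- In units of σY/|ξ| the excess over m enters through the sign ξ/|ξ| only, and Y factors out. -/
theorem affine_add_threshold {μ σ ξ m τ : ℝ} (hσ : 0 < σ) (hξ : ξ ≠ 0) :
    1 + ξ * ((m + σ * (1 + ξ * ((m - μ) / σ)) / |ξ| * τ - μ) / σ) =
      (1 + ξ * ((m - μ) / σ)) * (1 + ξ / |ξ| * τ) := by
  have hξ' : |ξ| ≠ 0 := abs_ne_zero.2 hξ
  field_simp
  ring

/-- Threshold stability of the Generalised Pareto density. -/
theorem gpdPDF_add {μ σ ξ m τ : ℝ} (hσ : 0 < σ) (hξ : ξ ≠ 0) (hm : μ < m)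
    (hy : 0 < 1 + ξ * ((m - μ) / σ)) (hτ : 0 ≤ τ) :
    gpdPDF μ σ ξ (m + σ * (1 + ξ * ((m - μ) / σ)) / |ξ| * τ) =
      gpdPDF μ σ ξ m * posPow (1 + ξ / |ξ| * τ) (-1 - 1 / ξ) := by
  set Y := 1 + ξ * ((m - μ) / σ) with hY
  have h1 := affine_add_threshold (μ := μ) (m := m) (τ := τ) hσ hξ
  rw [← hY] at h1
  have h2 : μ < m + σ * Y / |ξ| * τ :=
    lt_add_of_lt_of_nonneg hm (mul_nonneg (div_nonneg (by positivity) (abs_nonneg _)) hτ)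
  rw [gpdPDF, gpdPDF, if_neg hξ, if_neg hξ, h1, ← hY, if_pos (And.intro hm hy)]
  by_cases h : 0 < 1 + ξ / |ξ| * τ
  · rw [if_pos ⟨h2, mul_pos hy h⟩, posPow_of_pos h, Real.mul_rpow hy.le h.le, mul_assoc]
  · rw [if_neg fun h' => h (pos_of_mul_pos_right h'.2 hy.le), posPow_of_nonpos (not_lt.1 h),
      mul_zero]

/-- Threshold stability of the Generalised Pareto survival function. -/
theorem posPow_add {μ σ ξ m τ : ℝ} (hσ : 0 < σ) (hξ : ξ ≠ 0)
    (hy : 0 < 1 + ξ * ((m - μ) / σ)) (a : ℝ) :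
    posPow (1 + ξ * ((m + σ * (1 + ξ * ((m - μ) / σ)) / |ξ| * τ - μ) / σ)) a =
      (1 + ξ * ((m - μ) / σ)) ^ a * posPow (1 + ξ / |ξ| * τ) a := by
  set Y := 1 + ξ * ((m - μ) / σ) with hY
  have h1 := affine_add_threshold (μ := μ) (m := m) (τ := τ) hσ hξ
  rw [← hY] at h1
  rw [h1]
  by_cases h : 0 < 1 + ξ / |ξ| * τ
  · rw [posPow_of_pos h, posPow_of_pos (mul_pos hy h), Real.mul_rpow hy.le h.le]
  · rw [posPow_of_nonpos (not_lt.1 h),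
      posPow_of_nonpos (mul_nonpos_of_nonneg_of_nonpos hy.le (not_lt.1 h)), mul_zero]

/-! ### Separating the minimum from the rescaled range -/

theorem lintegral_jointDensity_Ioi {n : ℕ} {f : ℝ → ENNReal} (hf : Measurable f)
    {t : Fin (n + 1) → ℝ} (ht : t ∈ admissible n) (u : ℝ) :
    ∫⁻ s in Ioi u, jointDensity f (t, s) = ((n + 3).factorial : ENNReal) *
      ∫⁻ m, ∫⁻ r in Ioi (0 : ℝ), ENNReal.ofReal (r ^ (n + 1)) *
        (f m * ((∏ j, f (m + r * t j)) * f (m + r))) * ∫⁻ x in Ioi (m + r * u), f x := by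
  have hK : Measurable fun q : (ℝ × ℝ) × ℝ => jointKernel f t q.1.1 q.1.2 q.2 :=
    (measurable_jointKernel hf).comp (f := fun q : (ℝ × ℝ) × ℝ => (((t, q.1.1), q.1.2), q.2))
      (by fun_prop)
  simp only [jointDensity, indicator_of_mem (show (t, _) ∈ admissible n ×ˢ (univ : Set ℝ) from
    ⟨ht, trivial⟩)]
  rw [lintegral_const_mul' _ _ (ENNReal.natCast_ne_top _),
    lintegral_lintegral_swap (f := fun s m => ∫⁻ r in Ioi (0 : ℝ), jointKernel f t s m r)
      hK.lintegral_prod_right'.aemeasurable]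
  congr 1
  refine lintegral_congr fun m => ?_
  rw [lintegral_lintegral_swap (f := fun s r => jointKernel f t s m r)
    (hK.comp (f := fun q : ℝ × ℝ => ((q.1, m), q.2)) (by fun_prop)).aemeasurable]
  refine setLIntegral_congr_fun measurableSet_Ioi fun r hr => ?_
  have hr : 0 < r := hr
  have e : ∫⁻ x in Ioi (m + r * u), f x = ENNReal.ofReal r * ∫⁻ s in Ioi u, f (m + r * s) := by
    rw [← lintegral_indicator measurableSet_Ioi, lintegral_affine volume m hr.ne',
      Module.finrank_self, pow_one, abs_of_pos hr, ← lintegral_indicator measurableSet_Ioi]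
    congr 1
    refine lintegral_congr fun s => ?_
    simp only [indicator, mem_Ioi, smul_eq_mul, add_lt_add_iff_left, mul_lt_mul_iff_right₀ hr]
  simp only [jointKernel, ← mul_assoc]
  rw [lintegral_const_mul _ (by fun_prop), e, pow_succ r (n + 1),
    ENNReal.ofReal_mul (by positivity)]
  ring

/-- The integrand, in the range `w` relative to the scale of the excesses, of the exceedance
integral of the Generalised Pareto Distribution. -/
def scaledKernel {n : ℕ} (ξ : ℝ) (t : Fin (n + 1) → ℝ) (u w : ℝ) : ℝ :=
  w ^ (n + 1) * ((∏ j, posPow (1 + ξ / |ξ| * (w * t j)) (-1 - 1 / ξ)) *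
    posPow (1 + ξ / |ξ| * w) (-1 - 1 / ξ)) * posPow (1 + ξ / |ξ| * (w * u)) (-(1 / ξ))

theorem lintegral_exceedance_range {n : ℕ} {μ σ ξ m u : ℝ} (hσ : 0 < σ) (hξ : ξ ≠ 0)
    {t : Fin (n + 1) → ℝ} (ht : t ∈ admissible n) (hu : 1 < u) (hm : μ < m)
    (hy : 0 < 1 + ξ * ((m - μ) / σ)) :
    ∫⁻ r in Ioi (0 : ℝ), ENNReal.ofReal (r ^ (n + 1)) *
      (ENNReal.ofReal (gpdPDF μ σ ξ m) * ((∏ j, ENNReal.ofReal (gpdPDF μ σ ξ (m + r * t j))) *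
        ENNReal.ofReal (gpdPDF μ σ ξ (m + r)))) *
        ∫⁻ x in Ioi (m + r * u), ENNReal.ofReal (gpdPDF μ σ ξ x) =
    ENNReal.ofReal ((|ξ| ^ (n + 2))⁻¹ * (gpdPDF μ σ ξ m *
      (1 + ξ * ((m - μ) / σ)) ^ (-((n + 3 : ℝ) / ξ)))) *
      ∫⁻ w in Ioi (0 : ℝ), ENNReal.ofReal (scaledKernel ξ t u w) := by
  set Y := 1 + ξ * ((m - μ) / σ) with hY
  have hξ' : 0 < |ξ| := abs_pos.2 hξ
  set ρ := σ * Y / |ξ| with hρ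
  have hρ0 : 0 < ρ := by positivity
  have hg := gpdPDF_nonneg hσ ξ (μ := μ)
  have hgm : gpdPDF μ σ ξ m = σ⁻¹ * Y ^ (-1 - 1 / ξ) := by
    rw [gpdPDF, if_neg hξ, if_pos (And.intro hm hy)]
  -- Scale times density is the survival function over |ξ|. It occurs n + 2 times: r^(n+1) dr gives
  -- n + 2 factors ρ, and the sample points above m give n + 2 factors of the density at m. The
  -- survival factor of the new point makes n + 3 powers in all.
  have hρg : ρ * gpdPDF μ σ ξ m = Y ^ (-(1 / ξ)) / |ξ| := by
    rw [hgm, hρ, sub_eq_add_neg, Real.rpow_add hy, Real.rpow_neg_one]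
    field_simp
  have hadd : ∀ τ : ℝ, 0 ≤ τ → gpdPDF μ σ ξ (m + ρ * τ) =
      gpdPDF μ σ ξ m * posPow (1 + ξ / |ξ| * τ) (-1 - 1 / ξ) := fun τ hτ =>
    gpdPDF_add hσ hξ hm hy hτ
  rw [← lintegral_indicator measurableSet_Ioi, lintegral_affine volume (0 : ℝ) hρ0.ne',
    Module.finrank_self, pow_one, abs_of_pos hρ0,
    ← lintegral_const_mul' _ _ ENNReal.ofReal_ne_top,
    ← lintegral_const_mul' _ _ ENNReal.ofReal_ne_top, ← lintegral_indicator measurableSet_Ioi]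
  refine lintegral_congr fun w => ?_
  by_cases hw : 0 < w
  · have hu0 : 0 ≤ u := by linarith
    rw [indicator_of_mem (show (0 : ℝ) + ρ • w ∈ Ioi (0 : ℝ) by simp [hρ0, hw]),
      indicator_of_mem (show w ∈ Ioi (0 : ℝ) from hw)]
    simp only [zero_add, smul_eq_mul, mul_assoc ρ w]
    rw [lintegral_gpdPDF_Ioi hσ hξ (by have : 0 ≤ ρ * (w * u) := by positivity
                                       linarith), posPow_add hσ hξ hy, ← hY,
      hadd w hw.le, Finset.prod_congr rfl fun j _ => by
        rw [hadd (w * t j) (mul_nonneg hw.le (ht.2 j).1)],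
      ← ENNReal.ofReal_prod_of_nonneg fun j _ => mul_nonneg (hg m) (posPow_nonneg _ _)]
    have hP : 0 ≤ ∏ j, gpdPDF μ σ ξ m * posPow (1 + ξ / |ξ| * (w * t j)) (-1 - 1 / ξ) :=
      Finset.prod_nonneg fun j _ => mul_nonneg (hg m) (posPow_nonneg _ _)
    have hY0 : 0 ≤ Y ^ (-(1 / ξ)) := Real.rpow_nonneg hy.le _
    have hQ := posPow_nonneg (1 + ξ / |ξ| * w) (-1 - 1 / ξ)
    have hgm0 := hg m
    have hYn := Real.rpow_nonneg hy.le (-((n + 3 : ℝ) / ξ))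
    rw [← ENNReal.ofReal_mul hP, ← ENNReal.ofReal_mul hgm0,
      ← ENNReal.ofReal_mul (by positivity), ← ENNReal.ofReal_mul (by positivity),
      ← ENNReal.ofReal_mul hρ0.le, ← ENNReal.ofReal_mul (by positivity)]
    congr 1
    have hYpow : Y ^ (-((n + 3 : ℝ) / ξ)) = (Y ^ (-(1 / ξ))) ^ (n + 2) * Y ^ (-(1 / ξ)) := by
      rw [← pow_succ, ← Real.rpow_natCast, ← Real.rpow_mul hy.le]
      congr 1
      push_cast
      ring
    rw [Finset.prod_mul_distrib, Finset.prod_const, Finset.card_univ, Fintype.card_fin, hYpow,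
      show (|ξ| ^ (n + 2))⁻¹ * (gpdPDF μ σ ξ m * ((Y ^ (-(1 / ξ))) ^ (n + 2) * Y ^ (-(1 / ξ)))) =
        (Y ^ (-(1 / ξ)) / |ξ|) ^ (n + 2) * (gpdPDF μ σ ξ m * Y ^ (-(1 / ξ))) by
        rw [div_pow]; ring, ← hρg, scaledKernel]
    ring_nf
  · rw [indicator_of_notMem (show (0 : ℝ) + ρ • w ∉ Ioi (0 : ℝ) by
      simpa [hρ0] using hw), indicator_of_notMem (show w ∉ Ioi (0 : ℝ) from hw), mul_zero]

theorem exceedance_gpd {n : ℕ} {μ σ ξ u : ℝ} (hσ : 0 < σ) (hξ : ξ ≠ 0)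
    {t : Fin (n + 1) → ℝ} (ht : t ∈ admissible n) (hu : 1 < u) :
    ∫⁻ s in Ioi u, jointDensity (fun x => ENNReal.ofReal (gpdPDF μ σ ξ x)) (t, s) =
      ENNReal.ofReal (((n + 3).factorial : ℝ) / (n + 4) * (|ξ| ^ (n + 2))⁻¹) *
        ∫⁻ w in Ioi (0 : ℝ), ENNReal.ofReal (scaledKernel ξ t u w) := by
  rw [lintegral_jointDensity_Ioi (measurable_gpdPDF μ σ ξ).ennreal_ofReal ht]
  set I := ∫⁻ w in Ioi (0 : ℝ), ENNReal.ofReal (scaledKernel ξ t u w)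
  have h : ∀ m : ℝ, ∫⁻ r in Ioi (0 : ℝ), ENNReal.ofReal (r ^ (n + 1)) *
      (ENNReal.ofReal (gpdPDF μ σ ξ m) * ((∏ j, ENNReal.ofReal (gpdPDF μ σ ξ (m + r * t j))) *
        ENNReal.ofReal (gpdPDF μ σ ξ (m + r)))) *
        ∫⁻ x in Ioi (m + r * u), ENNReal.ofReal (gpdPDF μ σ ξ x) =
      (Ioi μ).indicator (fun m => ENNReal.ofReal ((|ξ| ^ (n + 2))⁻¹) *
        ENNReal.ofReal (gpdPDF μ σ ξ m * (1 + ξ * ((m - μ) / σ)) ^ (-((n + 3 : ℝ) / ξ)))) m * I := by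
    intro m
    by_cases hm : μ < m ∧ 0 < 1 + ξ * ((m - μ) / σ)
    · rw [lintegral_exceedance_range hσ hξ ht hu hm.1 hm.2,
        indicator_of_mem (show m ∈ Ioi μ from hm.1), ENNReal.ofReal_mul (by positivity)]
    · have h0 : gpdPDF μ σ ξ m = 0 := by rw [gpdPDF, if_neg hξ, if_neg hm]
      simp [h0, indicator]
  have hm : Measurable fun m => ENNReal.ofReal
      (gpdPDF μ σ ξ m * (1 + ξ * ((m - μ) / σ)) ^ (-((n + 3 : ℝ) / ξ))) := by
    have := measurable_gpdPDF μ σ ξ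
    fun_prop
  -- The N-th power of the survival function against the density, over the whole support: this is
  -- the factor 1/(N+1).
  have hS := lintegral_gpdPDF_mul_rpow (κ := n + 3) hσ hξ (le_refl μ) (by simp) (by positivity)
  rw [lintegral_congr h, lintegral_mul_const _ ((hm.const_mul _).indicator measurableSet_Ioi),
    lintegral_indicator measurableSet_Ioi, lintegral_const_mul' _ _ ENNReal.ofReal_ne_top, hS,
    ← mul_assoc, ← ENNReal.ofReal_natCast, ← ENNReal.ofReal_mul (by positivity),
    ← ENNReal.ofReal_mul (by positivity)]
  congr 2
  simp only [sub_self, zero_div, mul_zero, add_zero, Real.one_rpow]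
  rw [add_assoc]
  norm_num
  ring

/-! ### The range integral as an Euler integral -/

theorem kappa_castSucc {n : ℕ} (t : Fin (n + 1) → ℝ) (u : ℝ) (j : Fin (n + 1)) :
    kappa t u j.castSucc = 1 - t 0 / Fin.snoc (α := fun _ => ℝ) (Fin.tail t) 1 j := by
  simp [kappa]

theorem kappa_last {n : ℕ} (t : Fin (n + 1) → ℝ) (u : ℝ) :
    kappa t u (Fin.last (n + 1)) = 1 - t 0 / u := by
  simp [kappa]

theorem le_snoc_tail {n : ℕ} {t : Fin (n + 1) → ℝ} (ht : t ∈ admissible n) (j : Fin (n + 1)) :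
    t 0 ≤ Fin.snoc (α := fun _ => ℝ) (Fin.tail t) 1 j := by
  induction j using Fin.lastCases with
  | last => simpa using (ht.2 0).2
  | cast j => simpa [Fin.tail] using ht.1 (Fin.zero_le _)

theorem abs_kappa_lt_one {n : ℕ} {t : Fin (n + 1) → ℝ} (ht : t ∈ admissible n) (h0 : 0 < t 0)
    {u : ℝ} (hu : 1 < u) (i : Fin (n + 2)) : |kappa t u i| < 1 := by
  have h : ∀ T : ℝ, t 0 ≤ T → |1 - t 0 / T| < 1 := fun T hT => by
    have h1 : 0 < t 0 / T := div_pos h0 (h0.trans_le hT)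
    have h2 : t 0 / T ≤ 1 := div_le_one_of_le₀ hT (h0.trans_le hT).le
    rw [abs_lt]
    constructor <;> linarith
  induction i using Fin.lastCases with
  | last => rw [kappa_last]; exact h u ((ht.2 0).2.trans hu.le)
  | cast j => rw [kappa_castSucc]; exact h _ (le_snoc_tail ht j)

theorem image_substitution {c : ℝ} (hc : 0 < c) :
    (fun v : ℝ => (v⁻¹ - 1) / c) '' Ioo 0 1 = Ioi 0 := by
  ext w
  simp only [mem_image, mem_Ioo, mem_Ioi]
  constructor
  · rintro ⟨v, ⟨h0, h1⟩, rfl⟩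
    exact div_pos (sub_pos.2 ((one_lt_inv₀ h0).2 h1)) hc
  · intro hw
    have : 0 < w * c := mul_pos hw hc
    refine ⟨(1 + w * c)⁻¹, ⟨by positivity, inv_lt_one_of_one_lt₀ (by linarith)⟩, ?_⟩
    field_simp
    ring

theorem lintegral_substitution {c : ℝ} (hc : 0 < c) (g : ℝ → ENNReal) :
    ∫⁻ w in Ioi (0 : ℝ), g w =
      ∫⁻ v in Ioo (0 : ℝ) 1, ENNReal.ofReal ((v ^ 2)⁻¹ / c) * g ((v⁻¹ - 1) / c) := by
  rw [← image_substitution hc, lintegral_image_eq_lintegral_abs_deriv_mul measurableSet_Ioo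
    (f' := fun v => -(v ^ 2)⁻¹ / c)]
  · refine setLIntegral_congr_fun measurableSet_Ioo fun v hv => ?_
    simp only [neg_div, abs_neg]
    rw [abs_of_nonneg (by positivity)]
  · intro v hv
    exact (((hasDerivAt_inv hv.1.ne').sub_const 1).div_const c).hasDerivWithinAt
  · intro v hv w hw h
    have h1 : v⁻¹ - 1 = w⁻¹ - 1 := (div_left_inj' hc.ne').1 h
    exact inv_injective (sub_left_injective h1)

theorem lintegral_scaledKernel_of_pos {n : ℕ} {ξ α u : ℝ} (hξ : 0 < ξ) (hα : α = 1 / ξ)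
    {t : Fin (n + 1) → ℝ} (ht : t ∈ admissible n) (h0 : 0 < t 0) (hu : 1 < u) :
    ∫⁻ w in Ioi (0 : ℝ), ENNReal.ofReal (scaledKernel ξ t u w) =
      ENNReal.ofReal (t 0 ^ ((n + 2 : ℝ) * α - 1) / ((∏ j : Fin n, t j.succ) ^ (1 + α) * u ^ α) *
        (Real.Gamma ((n + 3) * α) * Real.Gamma (n + 2) / Real.Gamma (n + 2 + (n + 3) * α) *
          lauricellaFD ((n + 3) * α) (heavyParams n α) (n + 2 + (n + 3) * α) (kappa t u))) := by
  have hα0 : 0 < α := by rw [hα]; positivity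
  have hu0 : 0 < u := by linarith
  set T : Fin (n + 1) → ℝ := Fin.snoc (α := fun _ => ℝ) (Fin.tail t) 1 with hT
  have hT0 : ∀ j, 0 < T j := fun j => h0.trans_le (le_snoc_tail ht j)
  have hTprod : ∏ j, T j = ∏ j : Fin n, t j.succ := by
    simp [hT, Fin.prod_univ_castSucc, Fin.tail]
  have hprod0 : 0 < ∏ j : Fin n, t j.succ := hTprod ▸ Finset.prod_pos fun j _ => hT0 j
  set C := t 0 ^ ((n + 2 : ℝ) * α - 1) / ((∏ j : Fin n, t j.succ) ^ (1 + α) * u ^ α) with hC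
  have hC0 : 0 ≤ C := by positivity
  have key := lauricella_lintegral (a := (n + 3) * α) (c := n + 2 + (n + 3) * α)
    (by positivity) (by linarith [(n.cast_nonneg : (0 : ℝ) ≤ n)]) (heavyParams n α) (kappa t u)
    (abs_kappa_lt_one ht h0 hu)
  rw [show (n + 2 + (n + 3) * α - (n + 3) * α : ℝ) = n + 2 by ring] at key
  rw [ENNReal.ofReal_mul hC0, ← key, lintegral_substitution h0,
    ← lintegral_const_mul' _ _ ENNReal.ofReal_ne_top]
  refine setLIntegral_congr_fun measurableSet_Ioo fun v hv => ?_
  rw [← ENNReal.ofReal_mul (by positivity), ← ENNReal.ofReal_mul hC0]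
  congr 1
  obtain ⟨hv0, hv1⟩ := hv
  have hv1' : 0 < 1 - v := by linarith
  set w := (v⁻¹ - 1) / t 0 with hw
  have hwv : w = (1 - v) / (v * t 0) := by rw [hw]; field_simp
  have hw0 : 0 < w := by rw [hwv]; positivity
  have hq : -1 - 1 / ξ = -(1 + α) := by rw [hα]; ring
  -- This is why the arguments are κ = 1 - t_1/S. For S = t_1 the argument vanishes and only 1/v is
  -- left, so t_1 contributes no argument of its own.
  have hone : ∀ S : ℝ, 0 < S → 1 + w * S = S / (t 0 * v) * (1 - v * (1 - t 0 / S)) := by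
    intro S hS
    rw [hwv]
    field_simp
    ring
  have hfac : ∀ S : ℝ, t 0 ≤ S → 0 < 1 - v * (1 - t 0 / S) := fun S hS => by
    have : 0 < t 0 / S := div_pos h0 (h0.trans_le hS)
    nlinarith
  have hmid : ∀ S b : ℝ, t 0 ≤ S → (1 + w * S) ^ (-b) =
      S ^ (-b) * (t 0 * v) ^ b * (1 - v * (1 - t 0 / S)) ^ (-b) := fun S b hS => by
    have hS0 := h0.trans_le hS
    rw [hone S hS0, Real.mul_rpow (by positivity) (hfac S hS).le,
      Real.div_rpow hS0.le (by positivity), Real.rpow_neg (by positivity : 0 ≤ t 0 * v),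
      div_inv_eq_mul]
  have hk1 : scaledKernel ξ t u w = w ^ (n + 1) *
      ((1 + w * t 0) ^ (-(1 + α)) * ∏ j, (1 + w * T j) ^ (-(1 + α))) * (1 + w * u) ^ (-α) := by
    have hpos : ∀ S : ℝ, 0 ≤ S → 0 < 1 + w * S := fun S hS => by positivity
    rw [scaledKernel, abs_of_pos hξ, div_self hξ.ne', hq, ← hα]
    simp only [one_mul]
    rw [posPow_of_pos (hpos u hu0.le), posPow_of_pos (by linarith),
      Finset.prod_congr rfl fun j _ => posPow_of_pos (hpos (t j) (ht.2 j).1) _]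
    rw [Fin.prod_univ_succ, hT, Fin.prod_univ_castSucc (n := n)]
    simp only [Fin.snoc_castSucc, Fin.snoc_last, Fin.tail, mul_one, mul_assoc]
  have hk2 : ∏ j, (1 + w * T j) ^ (-(1 + α)) = (∏ j : Fin n, t j.succ) ^ (-(1 + α)) *
      ((t 0 * v) ^ (1 + α)) ^ (n + 1) * ∏ j, (1 - v * (1 - t 0 / T j)) ^ (-(1 + α)) := by
    rw [Finset.prod_congr rfl fun j _ => hmid (T j) (1 + α) (le_snoc_tail ht j),
      Finset.prod_mul_distrib, Finset.prod_mul_distrib, Finset.prod_const, Finset.card_univ,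
      Fintype.card_fin, Real.finsetProd_rpow _ _ fun j _ => (hT0 j).le, hTprod]
  have hk3 : ∏ i, (1 - v * kappa t u i) ^ (-heavyParams n α i) =
      (∏ j, (1 - v * (1 - t 0 / T j)) ^ (-(1 + α))) * (1 - v * (1 - t 0 / u)) ^ (-α) := by
    rw [Fin.prod_univ_castSucc]
    simp only [kappa_castSucc, kappa_last, heavyParams, Fin.snoc_castSucc, Fin.snoc_last, hT]
  have hk4 : 1 + w * t 0 = v⁻¹ := by rw [hwv]; field_simp; ring
  rw [hk1, hk2, hk3, hk4, hmid u α ((ht.2 0).2.trans hu.le), hC]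
  set A := ∏ j, (1 - v * (1 - t 0 / T j)) ^ (-(1 + α))
  set D := (1 - v * (1 - t 0 / u)) ^ (-α)
  have hv2 : (1 - v) ^ (((n : ℝ) + 2) - 1) = (1 - v) ^ (n + 1) := by
    rw [← Real.rpow_natCast]; congr 1; push_cast; ring
  have ht0pow : t 0 ^ (((n : ℝ) + 2) * α - 1) =
      (t 0 ^ (1 + α)) ^ (n + 1) * t 0 ^ α / (t 0 * t 0 ^ (n + 1)) := by
    rw [← pow_succ', eq_div_iff (by positivity), ← Real.rpow_natCast, ← Real.rpow_natCast,
      ← Real.rpow_mul h0.le, ← Real.rpow_add h0, ← Real.rpow_add h0]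
    congr 1; push_cast; ring
  have hvpow : v ^ (((n : ℝ) + 3) * α - 1) =
      (v ^ (1 + α)) ^ (n + 1) * v ^ α * v ^ (1 + α) / (v ^ 2 * v ^ (n + 1)) := by
    rw [← pow_add, eq_div_iff (by positivity), ← Real.rpow_natCast, ← Real.rpow_natCast,
      ← Real.rpow_mul hv0.le, ← Real.rpow_add hv0, ← Real.rpow_add hv0, ← Real.rpow_add hv0]
    congr 1; push_cast; ring
  rw [hv2, ht0pow, hvpow, Real.mul_rpow h0.le hv0.le, Real.mul_rpow h0.le hv0.le,
    Real.rpow_neg hprod0.le, Real.rpow_neg hu0.le, Real.inv_rpow hv0.le, Real.rpow_neg hv0.le,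
    inv_inv, hwv, div_pow, mul_pow, mul_pow]
  field_simp

theorem abs_boundedArgs_lt_one {n : ℕ} {t : Fin (n + 1) → ℝ} (ht : t ∈ admissible n)
    {u : ℝ} (hu : 1 < u) (i : Fin (n + 2)) : |boundedArgs t u i| < 1 := by
  have h : ∀ T : ℝ, 0 ≤ T → T ≤ 1 → |T / u| < 1 := fun T hT hT1 => by
    rw [abs_of_nonneg (div_nonneg hT (by linarith)), div_lt_one (by linarith)]
    linarith
  induction i using Fin.lastCases with
  | last => simpa [boundedArgs] using h 1 zero_le_one le_rfl
  | cast j => simpa [boundedArgs] using h (t j) (ht.2 j).1 (ht.2 j).2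

/-- Under w = v/u the survival factor becomes (1 - v)^β and vanishes for v ≥ 1. For 0 < v < 1 all
other bases 1 - v t_j/u and 1 - v/u are positive, since u > 1. The case t_1 = 0 is allowed. -/
theorem lintegral_scaledKernel_of_neg {n : ℕ} {ξ β u : ℝ} (hξ : ξ < 0) (hβ : β = -(1 / ξ))
    {t : Fin (n + 1) → ℝ} (ht : t ∈ admissible n) (hu : 1 < u) :
    ∫⁻ w in Ioi (0 : ℝ), ENNReal.ofReal (scaledKernel ξ t u w) =
      ENNReal.ofReal (1 / u ^ (n + 2) *
        (Real.Gamma (n + 2) * Real.Gamma (1 + β) / Real.Gamma (n + 3 + β) *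
          lauricellaFD (n + 2) (fun _ : Fin (n + 2) => 1 - β) (n + 3 + β) (boundedArgs t u))) := by
  have hβ0 : 0 < β := by rw [hβ, ← div_neg]; exact div_pos one_pos (by linarith)
  have hu0 : 0 < u := by linarith
  have key := lauricella_lintegral (a := n + 2) (c := n + 3 + β)
    (by positivity) (by linarith) (fun _ : Fin (n + 2) => 1 - β) (boundedArgs t u)
    (abs_boundedArgs_lt_one ht hu)
  rw [show (n + 3 + β - (n + 2) : ℝ) = 1 + β by ring] at key
  rw [ENNReal.ofReal_mul (by positivity), ← key, ← lintegral_indicator measurableSet_Ioi,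
    lintegral_affine volume (0 : ℝ) (inv_pos.2 hu0).ne', Module.finrank_self, pow_one,
    abs_of_pos (inv_pos.2 hu0), ← lintegral_const_mul' _ _ ENNReal.ofReal_ne_top,
    ← lintegral_const_mul' _ _ ENNReal.ofReal_ne_top, ← lintegral_indicator measurableSet_Ioo]
  refine lintegral_congr fun v => ?_
  have hk : scaledKernel ξ t u (u⁻¹ * v) = (u⁻¹ * v) ^ (n + 1) *
      ((∏ j, posPow (1 - v * (t j / u)) (β - 1)) * posPow (1 - v * (1 / u)) (β - 1)) *
        posPow (1 - v) β := by
    have hs : ξ / |ξ| = -1 := by rw [abs_of_neg hξ, div_neg, div_self hξ.ne]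
    have e : ∀ S : ℝ, 1 + -1 * (u⁻¹ * v * S) = 1 - v * (S / u) := fun S => by ring
    rw [scaledKernel, hs, ← hβ, show -1 - 1 / ξ = β - 1 by rw [hβ]; ring]
    simp only [e]
    rw [div_self hu0.ne', mul_one, ← mul_one (u⁻¹ * v), e, mul_one]
  by_cases hv0 : 0 < v
  · rw [indicator_of_mem (show (0 : ℝ) + u⁻¹ • v ∈ Ioi (0 : ℝ) by simp [hu0, hv0]), zero_add,
      smul_eq_mul, hk]
    by_cases hv1 : v < 1
    · rw [indicator_of_mem (show v ∈ Ioo (0 : ℝ) 1 from ⟨hv0, hv1⟩),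
        ← ENNReal.ofReal_mul (by positivity), ← ENNReal.ofReal_mul (by positivity)]
      congr 1
      have hpos : ∀ i, 0 < 1 - v * boundedArgs t u i := fun i => by
        have := abs_lt.1 (abs_boundedArgs_lt_one ht hu i)
        nlinarith
      have hb : ∀ j : Fin (n + 1), t j / u = boundedArgs t u j.castSucc := fun j => by
        simp [boundedArgs]
      have hbl : 1 / u = boundedArgs t u (Fin.last (n + 1)) := by simp [boundedArgs]
      rw [hbl, Finset.prod_congr rfl fun j _ => by rw [hb j, posPow_of_pos (hpos _)],
        posPow_of_pos (hpos _), posPow_of_pos (by linarith), neg_sub,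
        Fin.prod_univ_castSucc (n := n + 1),
        show (n : ℝ) + 2 - 1 = (n + 1 : ℕ) by push_cast; ring, Real.rpow_natCast,
        add_sub_cancel_left, mul_pow, inv_pow, one_div, pow_succ u (n + 1), mul_inv]
      ring
    · rw [indicator_of_notMem (show v ∉ Ioo (0 : ℝ) 1 from fun h => hv1 h.2),
        posPow_of_nonpos (by linarith : 1 - v ≤ 0)]
      simp
  · rw [indicator_of_notMem (show (0 : ℝ) + u⁻¹ • v ∉ Ioi (0 : ℝ) by simpa [hu0] using hv0),
      indicator_of_notMem (show v ∉ Ioo (0 : ℝ) 1 from fun h => hv0 h.1)]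
    simp

/-! ### From densities to exceedance probabilities -/

theorem ae_coord_zero_ne (n : ℕ) : ∀ᵐ t : Fin (n + 1) → ℝ, t 0 ≠ 0 :=
  (Measure.quasiMeasurePreserving_eval (fun _ : Fin (n + 1) => (volume : Measure ℝ)) 0).ae
    (Measure.ae_ne volume 0)

/-- By Fubini, for almost every t the two densities agree for almost every s. The exceptional set of
t does not involve u, so one null set serves all levels. -/
theorem ae_exceedanceIntegrand {n : ℕ} {p : (Fin (n + 1) → ℝ) × ℝ → ENNReal} (hp : Measurable p) :
    ∀ᵐ t : Fin (n + 1) → ℝ, ∀ u : ℝ,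
      exceedanceIntegrand (volume.withDensity p) t u = ∫⁻ s in Ioi u, p (t, s) := by
  have h := Measure.rnDeriv_withDensity (volume : Measure ((Fin (n + 1) → ℝ) × ℝ)) hp
  rw [Measure.volume_eq_prod] at h
  filter_upwards [Measure.ae_ae_of_ae_prod h] with t ht u
  exact lintegral_congr_ae (ae_restrict_of_ae ht)

theorem measure_exceedance {n : ℕ} {J : Measure ((Fin (n + 1) → ℝ) × ℝ)} [SigmaFinite J]
    (hJ : J ≪ volume) (hA : ∀ᵐ p ∂J, p.1 ∈ admissible n) {sT : (Fin (n + 1) → ℝ) → ℝ}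
    (hsT : Measurable sT) :
    J {p | sT p.1 < p.2} = ∫⁻ t in admissible n, exceedanceIntegrand J t (sT t) := by
  have hm : MeasurableSet {p : (Fin (n + 1) → ℝ) × ℝ | sT p.1 < p.2} :=
    measurableSet_lt (by fun_prop) measurable_snd
  have hAm : MeasurableSet (admissible n ×ˢ (univ : Set ℝ)) :=
    (measurableSet_admissible n).prod MeasurableSet.univ
  have e : J {p | sT p.1 < p.2} = J ({p | sT p.1 < p.2} ∩ admissible n ×ˢ univ) := by
    refine (measure_inter_conull ?_).symm
    refine measure_mono_null ?_ hA
    intro p hp h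
    exact hp ⟨h, trivial⟩
  rw [e]
  nth_rewrite 1 [← Measure.withDensity_rnDeriv_eq J volume hJ]
  rw [withDensity_apply _ (hm.inter hAm), ← lintegral_indicator (hm.inter hAm),
    Measure.volume_eq_prod, lintegral_prod _ ((Measure.measurable_rnDeriv _ _).indicator
      (hm.inter hAm)).aemeasurable, ← lintegral_indicator (measurableSet_admissible n)]
  refine lintegral_congr fun t => ?_
  by_cases ht : t ∈ admissible n
  · rw [indicator_of_mem ht, exceedanceIntegrand, ← lintegral_indicator measurableSet_Ioi]
    refine lintegral_congr fun s => ?_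
    simp [indicator, ht, Measure.volume_eq_prod]
  · simp [indicator, ht]

end GPDPredictor

end

open GPDPredictor in
theorem mainTheorem3 (n N : ℕ) (hN : N = n + 3)
    {Ω : Type*} [MeasurableSpace Ω] (P : Measure Ω) [IsProbabilityMeasure P]
    (μ σ ξ : ℝ) (hσ : 0 < σ) (hξ : ξ ≠ 0)
    (X : Fin (n + 4) → Ω → ℝ) (hX : ∀ i, Measurable (X i)) (hindep : iIndepFun X P)
    (hlaw : ∀ i, P.map (X i) = GPDPredictor.gpd μ σ ξ)
    (J : Measure ((Fin (n + 1) → ℝ) × ℝ))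
    (hJ : J = P.map (fun ω => GPDPredictor.normPair (fun i => X i ω))) :
    -- `(t, s)` has a joint density
    J ≪ volume ∧
    -- the exceedance probability of a predictor is the integral of its integrand
    (∀ sT : (Fin (n + 1) → ℝ) → ℝ, Measurable sT →
      (∀ t ∈ GPDPredictor.admissible n, 1 < sT t) →
      P {ω | sT (GPDPredictor.normPair (fun i => X i ω)).1
          < (GPDPredictor.normPair (fun i => X i ω)).2} =
        ∫⁻ t in GPDPredictor.admissible n, GPDPredictor.exceedanceIntegrand J t (sT t)) ∧
    -- heavy-tailed case
    (0 < ξ → ∀ α : ℝ, α = 1 / ξ →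
      ∀ᵐ t ∂(volume.restrict (GPDPredictor.admissible n)), ∀ u : ℝ, 1 < u →
        Summable (GPDPredictor.lauricellaTerm (N * α) (GPDPredictor.heavyParams n α)
          ((N - 1 : ℝ) + N * α) (GPDPredictor.kappa t u)) ∧
        GPDPredictor.exceedanceIntegrand J t u = ENNReal.ofReal
          ((N.factorial : ℝ) / (N + 1) * α ^ (N - 1)
            * (Real.Gamma (N - 1) * Real.Gamma (N * α) / Real.Gamma ((N - 1 : ℝ) + N * α))
            * (t 0 ^ ((N - 1 : ℝ) * α - 1) / ((∏ j : Fin n, t j.succ) ^ (1 + α) * u ^ α))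
            * GPDPredictor.lauricellaFD (N * α) (GPDPredictor.heavyParams n α)
                ((N - 1 : ℝ) + N * α) (GPDPredictor.kappa t u))) ∧
    -- bounded-tail case
    (ξ < 0 → ∀ β : ℝ, β = -(1 / ξ) →
      ∀ᵐ t ∂(volume.restrict (GPDPredictor.admissible n)), ∀ u : ℝ, 1 < u →
        Summable (GPDPredictor.lauricellaTerm (N - 1 : ℝ) (fun _ : Fin (n + 2) => 1 - β)
          (N + β) (GPDPredictor.boundedArgs t u)) ∧
        GPDPredictor.exceedanceIntegrand J t u = ENNReal.ofReal
          ((N.factorial : ℝ) / (N + 1) * β ^ (N - 1)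
            * (Real.Gamma (N - 1) * Real.Gamma (1 + β) / Real.Gamma (N + β))
            * (1 / u ^ (N - 1))
            * GPDPredictor.lauricellaFD (N - 1 : ℝ) (fun _ : Fin (n + 2) => 1 - β)
                (N + β) (GPDPredictor.boundedArgs t u))) := by
  subst hN
  have hf := (measurable_gpdPDF μ σ ξ).ennreal_ofReal
  -- Total mass 1 is inherited from the law of the first variable; it provides the σ-finiteness that
  -- `map_normPair` requires.
  have hprob : IsProbabilityMeasure
      (volume.withDensity fun x => ENNReal.ofReal (gpdPDF μ σ ξ x)) := by
    have h := hlaw 0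
    rw [gpd] at h
    exact h ▸ Measure.isProbabilityMeasure_map (hX 0).aemeasurable
  have hXm : Measurable fun ω i => X i ω := measurable_pi_iff.2 hX
  have hJd : J = volume.withDensity (jointDensity fun x => ENNReal.ofReal (gpdPDF μ σ ξ x)) := by
    rw [hJ, ← map_normPair hf, show (fun ω => normPair fun i => X i ω) =
      normPair ∘ fun ω i => X i ω from rfl, ← Measure.map_map measurable_normPair hXm,
      (iIndepFun_iff_map_fun_eq_pi_map fun i => (hX i).aemeasurable).1 hindep]
    simp only [hlaw, gpd]
  have hJac : J ≪ volume := hJd ▸ withDensity_absolutelyContinuous _ _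
  have hnm : Measurable fun ω => normPair fun i => X i ω := measurable_normPair.comp hXm
  have hJprob : IsProbabilityMeasure J := hJ ▸ Measure.isProbabilityMeasure_map hnm.aemeasurable
  have hex := ae_exceedanceIntegrand
    (measurable_jointDensity (n := n) hf)
  rw [← hJd] at hex
  have hfact : ((n + 3).factorial : ℝ) / ((n + 3 : ℕ) + 1) = ((n + 3).factorial : ℝ) / (n + 4) := by
    push_cast; ring
  have hsub : ((n + 3 : ℕ) : ℝ) - 1 = n + 2 := by push_cast; ring
  have hcast : ((n + 3 : ℕ) : ℝ) = n + 3 := by push_cast; ring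
  refine ⟨hJac, fun sT hsT _ => ?_, fun hpos α hα => ?_, fun hneg β hβ => ?_⟩
  · rw [← measure_exceedance hJac ?_ hsT, hJ, Measure.map_apply hnm
      (measurableSet_lt (by fun_prop) measurable_snd)]
    · rfl
    · rw [hJ]
      refine (ae_map_iff hnm.aemeasurable
        (measurable_fst (measurableSet_admissible n))).2 (ae_of_all _ fun ω => ?_)
      exact normData_mem_admissible _
  · rw [ae_restrict_iff' (measurableSet_admissible n)]
    -- The null set t_1 = 0 is discarded: there the substitution divides by zero and κ_N = 1 leaves
    -- the domain of convergence used.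
    filter_upwards [hex, ae_coord_zero_ne n] with t hext ht0 ht u hu
    have h0 : 0 < t 0 := lt_of_le_of_ne (ht.2 0).1 ht0.symm
    have hα0 : 0 < α := by rw [hα]; positivity
    rw [hext u, exceedance_gpd hσ hξ ht hu, lintegral_scaledKernel_of_pos hpos hα ht h0 hu,
      hfact, hsub, hcast, ← ENNReal.ofReal_mul (by positivity)]
    refine ⟨(lauricella_euler (by positivity) (by linarith [(n.cast_nonneg : (0 : ℝ) ≤ n)])
      _ _ (abs_kappa_lt_one ht h0 hu)).1, ?_⟩
    rw [abs_of_pos hpos, show ξ = α⁻¹ by rw [hα, one_div, inv_inv], inv_pow, inv_inv]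
    congr 1
    rw [show n + 3 - 1 = n + 2 from rfl]
    ring
  · rw [ae_restrict_iff' (measurableSet_admissible n)]
    filter_upwards [hex] with t hext ht u hu
    have hβ0 : 0 < β := by rw [hβ, ← div_neg]; exact div_pos one_pos (by linarith)
    rw [hext u, exceedance_gpd hσ hξ ht hu, lintegral_scaledKernel_of_neg hneg hβ ht hu,
      hfact, hsub, hcast, ← ENNReal.ofReal_mul (by positivity)]
    refine ⟨(lauricella_euler (by positivity) (by linarith)
      _ _ (abs_boundedArgs_lt_one ht hu)).1, ?_⟩
    rw [abs_of_neg hneg, show -ξ = β⁻¹ by rw [hβ, ← div_neg, one_div, inv_inv], inv_pow, inv_inv]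
    congr 1
    rw [show n + 3 - 1 = n + 2 from rfl]
    ring
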